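/- For each $i\in\mathbb N$ let $\mathsf C_i=\ker \mathbf H_i\subseteq\mathbb F_2^{n_i}$ be a binary linear code with parity check matrix $\mathbf H_i\in\mathbb F_2^{m_i\times n_i}$, where $n_i\to\infty$. Assume the family is LDPC: for constants $w_{\rm bit},w_{\rm check}$ every column of $\mathbf H_i$ has at most $w_{\rm bit}$ and every row at most $w_{\rm check}$ nonzero entries. For a set $S$ of bits let $\Gamma_i(S)$ be the set of checks acting on at least one bit of $S$ (the neighbours of $S$ in the Tanner graph). Assume that the Tanner graphs are $(\delta(n_i),\gamma)$ smaller-set expanders with $\gamma>w_{\rm bit}/2$: $\delta(n)=o(n)$, and for every $i$ and every set $S$ of bits of $\mathsf C_i$ with $|S|\le\delta(n_i)$ one has $|\Gamma_i(S)|\ge\gamma|S|$. Assume moreover that $\delta(n)=\Omega(n^\beta)$ for some $0<\beta<1$. Glauber dynamics for $\mathsf C_i$ at inverse temperature $b$ is the Markov chain on $\mathbb F_2^{n_i}$ that in each step picks one of the $n_i$ bits uniformly at random and flips it with probability $e^{-b\Delta E}/(1+e^{-b\Delta E})$, where $\Delta E$ is the change which the flip causes in the energy $E(x)=|\mathbf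 H_i x|$, the number of violated checks. For a decoder $D:\mathbb F_2^{n_i}\to\mathsf C_i$ and a codeword $z$, the memory time is the first step $t\geq 0$ at which $D(X_t)\ne z$, where $X_0=z$ and $(X_t)$ follows Glauber dynamics. Then, at sufficiently low temperature, the family is self-correcting with memory time $\exp(\Omega(\delta(n_i)))$: there is $b_0>0$ such that for every $b\ge b_0$ there are a constant $c>0$ and decoders $D_i$ for the codes $\mathsf C_i$ with $$\max_{z\in\mathsf C_i}\ \mathbb P_z\bigl[\exists\, t\le e^{c\,\delta(n_i)}:\ D_i(X_t)\ne z\bigr]\longrightarrow 0\qquad(i\to\infty),$$ and $e^{c\,\delta(n_i)}\to\infty$. -/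

import Mathlib

open Filter Asymptotics

/-- Words of length `n` over the field with two elements. -/
abbrev Word (n : ℕ) : Type := Fin n → ZMod 2

/-- Parity check matrices of binary linear codes with `n` bits and `m` checks. -/
abbrev ParityCheck (m n : ℕ) : Type := Matrix (Fin m) (Fin n) (ZMod 2)

namespace ParityCheck

variable {m n : ℕ}

/-- `z` is a codeword: it satisfies all parity checks. -/
def IsCodeword (H : ParityCheck m n) (z : Word n) : Prop := H.mulVec z = 0

/-- The edge relation of the Tanner graph: bit `l` (left) is joined to check `r` (right). -/
def TannerAdj (H : ParityCheck m n) (l : Fin n) (r : Fin m) : Prop := H r l ≠ 0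

open Classical in
/-- The set `Γ(S)` of checks that are joined to some bit of `S`. -/
noncomputable def neighborSet (H : ParityCheck m n) (S : Finset (Fin n)) : Finset (Fin m) :=
  Finset.univ.filter (fun r => ∃ l ∈ S, H.TannerAdj l r)

open Classical in
/-- Every bit is in at most `wbit` checks and every check involves at most `wcheck` bits. -/
def DegreeBounded (H : ParityCheck m n) (wbit wcheck : ℕ) : Prop :=
  (∀ l : Fin n, (Finset.univ.filter (fun r : Fin m => H.TannerAdj l r)).card ≤ wbit) ∧
  (∀ r : Fin m, (Finset.univ.filter (fun l : Fin n => H.TannerAdj l r)).card ≤ wcheck)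

/-- The Tanner graph is a left `(δ, γ)` vertex expander. -/
def IsLeftExpander (H : ParityCheck m n) (δ γ : ℝ) : Prop :=
  ∀ S : Finset (Fin n), (S.card : ℝ) ≤ δ → γ * (S.card : ℝ) ≤ ((H.neighborSet S).card : ℝ)

/-- The energy of a word: the number of violated checks, i.e. the weight of its syndrome. -/
def energy (H : ParityCheck m n) (x : Word n) : ℕ := hammingNorm (H.mulVec x)

/-- The word `x` with bit `i` flipped. -/
def flipBit (x : Word n) (i : Fin n) : Word n := Function.update x i (x i + 1)

/-- Glauber probability of flipping bit `i` once it has been selected, at inverse temperature `b`: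
`exp (-b ΔE) / (1 + exp (-b ΔE))` with `ΔE` the change of energy. -/
noncomputable def flipProb (H : ParityCheck m n) (b : ℝ) (x : Word n) (i : Fin n) : ℝ :=
  Real.exp (-b * ((H.energy (flipBit x i) : ℝ) - (H.energy x : ℝ))) /
    (1 + Real.exp (-b * ((H.energy (flipBit x i) : ℝ) - (H.energy x : ℝ))))

/-- One step of Glauber dynamics, as a transition matrix: select one of the `n` bits uniformly at
random, then flip it with probability `flipProb`, otherwise stay. (Meaningful for `0 < n`.) -/
noncomputable def glauber (H : ParityCheck m n) (b : ℝ) (x y : Word n) : ℝ :=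
  (1 / (n : ℝ)) * ∑ i : Fin n,
    (H.flipProb b x i * (if y = flipBit x i then 1 else 0) +
      (1 - H.flipProb b x i) * (if y = x then 1 else 0))

/-- The probability that Glauber dynamics started in `z` follows the trajectory
`ω 0, ω 1, …, ω t`. -/
noncomputable def trajectoryProb (H : ParityCheck m n) (b : ℝ) (z : Word n) (t : ℕ)
    (ω : Fin (t + 1) → Word n) : ℝ :=
  (if ω 0 = z then 1 else 0) * ∏ s : Fin t, H.glauber b (ω s.castSucc) (ω s.succ)

/-- A decoder assigns a codeword to every word. -/
structure Decoder (H : ParityCheck m n) where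
  toFun : Word n → Word n
  isCodeword : ∀ x, H.IsCodeword (toFun x)

open Classical in
/-- The probability that the memory time is at most `t`: Glauber dynamics at inverse temperature
`b` is started in the word `z`, and at some step among `0, …, t` the decoder does not return `z`. -/
noncomputable def memoryFailureProb (H : ParityCheck m n) (b : ℝ) (D : H.Decoder) (z : Word n)
    (t : ℕ) : ℝ :=
  ∑ ω : Fin (t + 1) → Word n,
    if ∃ s, D.toFun (ω s) ≠ z then H.trajectoryProb b z t ω else 0

end ParityCheck

/-- A family of codes is smaller-set expanding with cutoff `δ` (a sublinear function of the number
of bits) and expansion `γ`: each Tanner graph is a left `(δ (n i), γ)` vertex expander. -/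
def IsSmallerSetExpanding {n m : ℕ → ℕ} (H : ∀ i, ParityCheck (m i) (n i))
    (δ : ℕ → ℝ) (γ : ℝ) : Prop :=
  (δ =o[atTop] fun k : ℕ => (k : ℝ)) ∧ ∀ i, (H i).IsLeftExpander (δ (n i)) γ

/-- The family is self-correcting at inverse temperature `b`, with memory time at least `T i`:
the `T i` diverge, and for some decoders (one for each code, working for all codewords of the
code) the time at which the decoder first fails to return the initial codeword exceeds `T i` with
probability tending to `1`, uniformly in the initial codeword. -/
def IsSelfCorrecting {n m : ℕ → ℕ} (H : ∀ i, ParityCheck (m i) (n i)) (b : ℝ) (T : ℕ → ℝ) : Prop :=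
  Tendsto T atTop atTop ∧
  ∃ D : ∀ i, (H i).Decoder, ∀ η : ℝ, 0 < η → ∀ᶠ i in atTop, ∀ z : Word (n i),
    (H i).IsCodeword z → (H i).memoryFailureProb b (D i) z ⌊T i⌋₊ ≤ η

/-! The true energy of an error pattern is bounded through a submodular substitute,
$f(B)=2|\Gamma(B)|-\sum_{l\in B}\deg l$ (`subEnergy`). Adding a bit to a larger pattern changes $f$
by less, so its heat bath dynamics is attractive. Adding a bit outside the current error set changes
the true energy by at least the change of $f$. Hence Glauber dynamics started in a codeword leaves a
downward closed set $\Omega$ of error patterns no sooner than this attractive dynamics does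
(`patternSurvival_le_wordSurvival`).

The attractive dynamics is reversible for the weight $e^{-bf}$. Started from equilibrium in
$\Omega$, it exits in each step with probability at most the weight of the outer boundary divided by
that of $\Omega$. By monotonicity the empty pattern survives at least as well
(`le_patternSurvival_empty`).

For $\Omega$ take the patterns that fill less than half of every connected set of $s$ bits, with $s$
a small multiple of $\delta$. A boundary pattern splits off a part $U$, with no check shared with
the rest and with size between $s/2$ and $\delta$ (`exists_separated_part`), so its weight
factorizes. Expansion gives $f(U)\ge(2\gamma-w_{\rm bit})|U|$, and $U$ fills a fixed fraction of a
connected set. At low temperature this energy beats the exponential number of such sets: a Peierls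
bound of order $n^2e^{-s}$ (`sum_outerBoundary_le`).

Decoding is unambiguous on $\Omega$: a connected set of $s$ bits on which two codewords differ
cannot be filled by two error patterns of less than half its size (`eq_of_errorSet_mem_sparseSets`).
-/

namespace ParityCheck

variable {m n : ℕ}

/-! ### Neighbourhoods and the submodular energy -/

open Classical in
/-- The checks acting on bit `l`. -/
noncomputable def checks (H : ParityCheck m n) (l : Fin n) : Finset (Fin m) :=
  Finset.univ.filter (fun r => H.TannerAdj l r)

lemma mem_checks (H : ParityCheck m n) (l : Fin n) (r : Fin m) :
    r ∈ H.checks l ↔ H.TannerAdj l r := by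
  simp [checks]

lemma mem_neighborSet (H : ParityCheck m n) (S : Finset (Fin n)) (r : Fin m) :
    r ∈ H.neighborSet S ↔ ∃ l ∈ S, H.TannerAdj l r := by
  simp [neighborSet]

lemma neighborSet_mono (H : ParityCheck m n) {S T : Finset (Fin n)} (h : S ⊆ T) :
    H.neighborSet S ⊆ H.neighborSet T := by
  intro r hr
  rw [mem_neighborSet] at hr ⊢
  obtain ⟨l, hl, hr⟩ := hr
  exact ⟨l, h hl, hr⟩

lemma neighborSet_union (H : ParityCheck m n) (S T : Finset (Fin n)) :
    H.neighborSet (S ∪ T) = H.neighborSet S ∪ H.neighborSet T := by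
  ext r
  simp only [mem_neighborSet, Finset.mem_union]
  grind

lemma neighborSet_singleton (H : ParityCheck m n) (i : Fin n) :
    H.neighborSet {i} = H.checks i := by
  ext r
  simp [mem_neighborSet, mem_checks]

/-- A submodular lower bound for the energy of an error pattern: a check acting on `j ≥ 1` bits of
`B` contributes `2 - j`. -/
noncomputable def subEnergy (H : ParityCheck m n) (B : Finset (Fin n)) : ℝ :=
  2 * ((H.neighborSet B).card : ℝ) - ∑ l ∈ B, ((H.checks l).card : ℝ)

/-- The change of `subEnergy` caused by adding the bit `i` to `B`. -/
noncomputable def subGain (H : ParityCheck m n) (B : Finset (Fin n)) (i : Fin n) : ℝ :=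
  2 * ((H.checks i \ H.neighborSet B).card : ℝ) - ((H.checks i).card : ℝ)

lemma subEnergy_insert (H : ParityCheck m n) {B : Finset (Fin n)} {i : Fin n} (hi : i ∉ B) :
    H.subEnergy (insert i B) = H.subEnergy B + H.subGain B i := by
  unfold subEnergy subGain
  rw [Finset.sum_insert hi]
  have h1 : H.neighborSet (insert i B) = H.neighborSet B ∪ H.checks i := by
    rw [Finset.insert_eq, neighborSet_union, neighborSet_singleton, Finset.union_comm]
  have h2 : (H.neighborSet (insert i B)).card
      = (H.neighborSet B).card + (H.checks i \ H.neighborSet B).card := by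
    rw [h1, ← Finset.union_sdiff_self_eq_union,
      Finset.card_union_of_disjoint Finset.disjoint_sdiff]
  rw [h2]
  push_cast
  ring

/-- Submodularity of $|\Gamma|$: a larger pattern leaves fewer new checks for `i`. Attractiveness of
the dynamics rests on this. -/
lemma subGain_antitone (H : ParityCheck m n) {A B : Finset (Fin n)} (h : A ⊆ B) (i : Fin n) :
    H.subGain B i ≤ H.subGain A i := by
  unfold subGain
  have : (H.checks i \ H.neighborSet B).card ≤ (H.checks i \ H.neighborSet A).card :=
    Finset.card_le_card (Finset.sdiff_subset_sdiff le_rfl (H.neighborSet_mono h))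
  have : ((H.checks i \ H.neighborSet B).card : ℝ) ≤ (H.checks i \ H.neighborSet A).card := by
    exact_mod_cast this
  linarith

/-- The only place where expansion enters. For $\gamma>w_{\rm bit}/2$ the coefficient is positive,
so small patterns cost energy proportional to their size. -/
lemma le_subEnergy (H : ParityCheck m n) {wbit wcheck : ℕ} {δ γ : ℝ}
    (hdeg : H.DegreeBounded wbit wcheck) (hexp : H.IsLeftExpander δ γ) {B : Finset (Fin n)}
    (hB : (B.card : ℝ) ≤ δ) : (2 * γ - wbit) * (B.card : ℝ) ≤ H.subEnergy B := by
  have h1 := hexp B hB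
  have h2 : ∑ l ∈ B, ((H.checks l).card : ℝ) ≤ ∑ l ∈ B, (wbit : ℝ) := by
    refine Finset.sum_le_sum fun l _ => ?_
    have := hdeg.1 l
    unfold checks
    exact_mod_cast this
  rw [Finset.sum_const, nsmul_eq_mul] at h2
  unfold subEnergy
  nlinarith

/-- If no check acts on both `U` and `R`, then `subEnergy` is additive. -/
lemma subEnergy_union (H : ParityCheck m n) {U R : Finset (Fin n)} (hd : Disjoint U R)
    (h : Disjoint (H.neighborSet U) (H.neighborSet R)) :
    H.subEnergy (U ∪ R) = H.subEnergy U + H.subEnergy R := by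
  unfold subEnergy
  rw [neighborSet_union, Finset.card_union_of_disjoint h, Finset.sum_union hd]
  push_cast
  ring

/-! ### Error sets and the energy change of a flip -/

/-- The set of positions where `x` differs from `z`. -/
def errorSet {n : ℕ} (z x : Word n) : Finset (Fin n) := Finset.univ.filter (fun i => x i ≠ z i)

lemma mem_errorSet (z x : Word n) (i : Fin n) : i ∈ errorSet z x ↔ x i ≠ z i := by
  simp [errorSet]

lemma errorSet_flipBit_of_notMem {z x : Word n} {i : Fin n} (hi : i ∉ errorSet z x) :
    errorSet z (flipBit x i) = insert i (errorSet z x) := by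
  rw [mem_errorSet, not_not] at hi
  ext j
  by_cases hj : j = i
  · subst hj
    simp [mem_errorSet, flipBit, hi]
  · simp [mem_errorSet, flipBit, hj]

lemma errorSet_flipBit_of_mem {z x : Word n} {i : Fin n} (hi : i ∈ errorSet z x) :
    errorSet z (flipBit x i) = (errorSet z x).erase i := by
  rw [mem_errorSet] at hi
  ext j
  by_cases hj : j = i
  · subst hj
    have : ∀ a c : ZMod 2, a ≠ c → a + 1 = c := by decide
    simp [mem_errorSet, flipBit, this _ _ hi]
  · simp [mem_errorSet, flipBit, hj]

lemma flipBit_flipBit (x : Word n) (i : Fin n) : flipBit (flipBit x i) i = x := by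
  have : ∀ a : ZMod 2, a + 1 + 1 = a := by decide
  unfold flipBit
  simp [this]

lemma mulVec_flipBit (H : ParityCheck m n) (x : Word n) (i : Fin n) (r : Fin m) :
    H.mulVec (flipBit x i) r = H.mulVec x r + H r i := by
  have : flipBit x i = x + Pi.single i 1 := by
    ext j
    by_cases hj : j = i
    · subst hj; simp [flipBit]
    · simp [flipBit, hj]
  rw [this, Matrix.mulVec_add]
  simp

/-- The energy as a sum over checks. -/
lemma energy_eq_sum (H : ParityCheck m n) (x : Word n) :
    (H.energy x : ℝ) = ∑ r, (if H.mulVec x r ≠ 0 then (1 : ℝ) else 0) := by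
  unfold energy hammingNorm
  rw [Finset.sum_boole]

/-- A check outside $\Gamma(B)$ sees no error, so it is satisfied and a flip at one of its bits
violates it: exactly $+1$. A check of `i` inside $\Gamma(B)$ contributes $-1$ at worst. -/
lemma energy_flipBit_sub (H : ParityCheck m n) {z x : Word n} (hz : H.IsCodeword z)
    {B : Finset (Fin n)} (hx : errorSet z x ⊆ B) (i : Fin n) :
    H.subGain B i ≤ (H.energy (flipBit x i) : ℝ) - H.energy x := by
  classical
  have hz2 : ∀ a : ZMod 2, a ≠ 0 → a = 1 := by decide
  have key : H.subGain B i = ∑ r, (if r ∈ H.checks i then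
      (if r ∈ H.neighborSet B then (-1 : ℝ) else 1) else 0) := by
    rw [← Finset.sum_filter, Finset.filter_mem_eq_inter, Finset.univ_inter,
      ← Finset.sum_filter_add_sum_filter_not _ (fun r => r ∈ H.neighborSet B)]
    have e1 : ∑ r ∈ (H.checks i).filter (fun r => r ∈ H.neighborSet B),
        (if r ∈ H.neighborSet B then (-1 : ℝ) else 1)
        = -(((H.checks i).filter (fun r => r ∈ H.neighborSet B)).card : ℝ) := by
      rw [Finset.sum_congr rfl (g := fun _ => (-1 : ℝ))]
      · simp
      · intro r hr
        rw [if_pos (Finset.mem_filter.1 hr).2]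
    have e2 : ∑ r ∈ (H.checks i).filter (fun r => r ∉ H.neighborSet B),
        (if r ∈ H.neighborSet B then (-1 : ℝ) else 1)
        = (((H.checks i).filter (fun r => r ∉ H.neighborSet B)).card : ℝ) := by
      rw [Finset.sum_congr rfl (g := fun _ => (1 : ℝ))]
      · simp
      · intro r hr
        rw [if_neg (Finset.mem_filter.1 hr).2]
    rw [e1, e2]
    have e3 := Finset.card_filter_add_card_filter_not (s := H.checks i)
      (fun r => r ∈ H.neighborSet B)
    unfold subGain
    rw [← Finset.filter_notMem_eq_sdiff, ← e3]
    push_cast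
    ring
  rw [key, energy_eq_sum, energy_eq_sum, ← Finset.sum_sub_distrib]
  refine Finset.sum_le_sum fun r _ => ?_
  rw [mulVec_flipBit]
  by_cases hr : r ∈ H.checks i
  · have h1 : H r i = 1 := hz2 _ ((H.mem_checks i r).1 hr)
    by_cases hB : r ∈ H.neighborSet B
    · simp only [hr, hB, if_true]
      split_ifs <;> norm_num
    · have h0 : H.mulVec x r = 0 := by
        have : H.mulVec x r = H.mulVec z r := by
          unfold Matrix.mulVec dotProduct
          refine Finset.sum_congr rfl fun l _ => ?_
          by_cases hl : l ∈ errorSet z x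
          · have : H r l = 0 := by
              by_contra h
              exact hB ((H.mem_neighborSet B r).2 ⟨l, hx hl, h⟩)
            change H r l * x l = H r l * z l
            rw [this, zero_mul, zero_mul]
          · rw [mem_errorSet, not_not] at hl
            rw [hl]
        rw [this]
        exact congrFun hz r
      simp [hr, hB, h0, h1]
  · have h1 : H r i = 0 := by
      by_contra h
      exact hr ((H.mem_checks i r).2 h)
    simp [hr, h1]

/-! ### Heat bath dynamics and monotone comparison -/

/-- The logistic function giving the acceptance probability of a move with energy change `u`. -/
noncomputable def acceptProb (b u : ℝ) : ℝ := Real.exp (-b * u) / (1 + Real.exp (-b * u))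

lemma acceptProb_nonneg (b u : ℝ) : 0 ≤ acceptProb b u := by
  unfold acceptProb; positivity

lemma acceptProb_le_one (b u : ℝ) : acceptProb b u ≤ 1 := by
  unfold acceptProb
  rw [div_le_one (by positivity)]
  linarith

lemma acceptProb_antitone {b : ℝ} (hb : 0 ≤ b) {u v : ℝ} (h : u ≤ v) :
    acceptProb b v ≤ acceptProb b u := by
  unfold acceptProb
  have : Real.exp (-b * v) ≤ Real.exp (-b * u) := Real.exp_le_exp.2 (by nlinarith)
  rw [div_le_div_iff₀ (by positivity) (by positivity)]
  nlinarith

lemma one_sub_acceptProb (b u : ℝ) : 1 - acceptProb b u = acceptProb b (-u) := by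
  unfold acceptProb
  have h : Real.exp (-b * -u) = (Real.exp (-b * u))⁻¹ := by
    rw [← Real.exp_neg]; ring_nf
  have := Real.exp_pos (-b * u)
  rw [h]
  field_simp
  ring

lemma flipProb_eq (H : ParityCheck m n) (b : ℝ) (x : Word n) (i : Fin n) :
    H.flipProb b x i = acceptProb b ((H.energy (flipBit x i) : ℝ) - H.energy x) := rfl

/-- Heat bath probability that bit `i` is put into the pattern `B`, for the energy `subEnergy`. -/
noncomputable def upProb (H : ParityCheck m n) (b : ℝ) (B : Finset (Fin n)) (i : Fin n) : ℝ :=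
  acceptProb b (H.subGain (B.erase i) i)

lemma upProb_mono (H : ParityCheck m n) {b : ℝ} (hb : 0 ≤ b) {A B : Finset (Fin n)} (h : A ⊆ B)
    (i : Fin n) : H.upProb b A i ≤ H.upProb b B i :=
  acceptProb_antitone hb (H.subGain_antitone (Finset.erase_subset_erase i h) i)

/-- Probability that the heat bath dynamics of `subEnergy` started in `B` stays in `Ω` up to
time `t`. -/
noncomputable def patternSurvival (H : ParityCheck m n) (b : ℝ) (Ω : Finset (Finset (Fin n))) :
    ℕ → Finset (Fin n) → ℝ
  | 0, B => if B ∈ Ω then 1 else 0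
  | t + 1, B => if B ∈ Ω then (1 / (n : ℝ)) * ∑ i : Fin n,
      (H.upProb b B i * patternSurvival H b Ω t (insert i B) +
        (1 - H.upProb b B i) * patternSurvival H b Ω t (B.erase i)) else 0

open Classical in
/-- Probability that Glauber dynamics started in `x` stays in `G` up to time `t`. -/
noncomputable def wordSurvival (H : ParityCheck m n) (b : ℝ) (G : Word n → Prop) :
    ℕ → Word n → ℝ
  | 0, x => if G x then 1 else 0
  | t + 1, x => if G x then ∑ y, H.glauber b x y * wordSurvival H b G t y else 0

lemma sum_glauber_mul (H : ParityCheck m n) (b : ℝ) (x : Word n) (f : Word n → ℝ) :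
    ∑ y, H.glauber b x y * f y = (1 / (n : ℝ)) * ∑ i : Fin n,
      (H.flipProb b x i * f (flipBit x i) + (1 - H.flipProb b x i) * f x) := by
  unfold glauber
  simp_rw [mul_assoc, ← Finset.mul_sum, Finset.sum_mul]
  rw [Finset.sum_comm]
  congr 1
  refine Finset.sum_congr rfl fun i _ => ?_
  simp_rw [add_mul, Finset.sum_add_distrib, mul_assoc, ← Finset.mul_sum]
  simp

lemma patternSurvival_nonneg (H : ParityCheck m n) (b : ℝ) (Ω : Finset (Finset (Fin n))) (t : ℕ)
    (B : Finset (Fin n)) : 0 ≤ H.patternSurvival b Ω t B := by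
  induction t generalizing B with
  | zero => unfold patternSurvival; split_ifs <;> norm_num
  | succ t ih =>
    unfold patternSurvival
    split_ifs
    · refine mul_nonneg (by positivity) (Finset.sum_nonneg fun i _ => ?_)
      exact add_nonneg (mul_nonneg (acceptProb_nonneg _ _) (ih _))
        (mul_nonneg (sub_nonneg.2 (acceptProb_le_one _ _)) (ih _))
    · rfl

lemma patternSurvival_of_notMem (H : ParityCheck m n) (b : ℝ) {Ω : Finset (Finset (Fin n))} (t : ℕ)
    {B : Finset (Fin n)} (hB : B ∉ Ω) : H.patternSurvival b Ω t B = 0 := by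
  cases t <;> simp [patternSurvival, hB]

/-- One site of a monotone coupling, in terms of expectations: the primed process has the worse
values and puts more mass on the worse of its two outcomes. -/
lemma convex_comb_le {p q a a' c c' : ℝ} (hp1 : p ≤ 1) (hp0 : 0 ≤ p) (hpq : p ≤ q)
    (ha : a' ≤ a) (hc : c' ≤ c) (hac : a' ≤ c') :
    q * a' + (1 - q) * c' ≤ p * a + (1 - p) * c := by
  nlinarith [mul_nonneg hp0 (sub_nonneg.2 ha), mul_nonneg (sub_nonneg.2 hp1) (sub_nonneg.2 hc),
    mul_nonneg (sub_nonneg.2 hpq) (sub_nonneg.2 hac)]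

/-- Inserting or erasing the same bit preserves inclusion, and the larger pattern inserts with
larger probability, so induction on time replaces an explicit coupling. -/
lemma patternSurvival_antitone (H : ParityCheck m n) {b : ℝ} (hb : 0 ≤ b)
    {Ω : Finset (Finset (Fin n))} (hΩ : ∀ A B, A ⊆ B → B ∈ Ω → A ∈ Ω) (t : ℕ)
    {A B : Finset (Fin n)} (h : A ⊆ B) :
    H.patternSurvival b Ω t B ≤ H.patternSurvival b Ω t A := by
  induction t generalizing A B with
  | zero =>
    by_cases hB : B ∈ Ω
    · simp [patternSurvival, hB, hΩ A B h hB]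
    · rw [patternSurvival_of_notMem H b 0 hB]
      exact patternSurvival_nonneg _ _ _ _ _
  | succ t ih =>
    by_cases hB : B ∈ Ω
    · simp only [patternSurvival, hB, hΩ A B h hB, if_true]
      refine mul_le_mul_of_nonneg_left (Finset.sum_le_sum fun i _ => ?_) (by positivity)
      exact convex_comb_le (acceptProb_le_one _ _) (acceptProb_nonneg _ _) (H.upProb_mono hb h i)
        (ih (Finset.insert_subset_insert i h)) (ih (Finset.erase_subset_erase i h))
        (ih ((Finset.erase_subset i B).trans (Finset.subset_insert i B)))
    · rw [patternSurvival_of_notMem H b _ hB]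
      exact patternSurvival_nonneg _ _ _ _ _

/-- Glauber dynamics also resamples the selected bit. By `energy_flipBit_sub` it makes that bit an
error with probability at most `upProb`, as long as the error set lies in `B`; both outcomes keep
the inclusion. -/
lemma patternSurvival_le_wordSurvival (H : ParityCheck m n) {b : ℝ} (hb : 0 ≤ b)
    {Ω : Finset (Finset (Fin n))} (hΩ : ∀ A B, A ⊆ B → B ∈ Ω → A ∈ Ω) {z : Word n}
    (hz : H.IsCodeword z) (t : ℕ) {x : Word n} {B : Finset (Fin n)} (h : errorSet z x ⊆ B) :
    H.patternSurvival b Ω t B ≤ H.wordSurvival b (fun x => errorSet z x ∈ Ω) t x := by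
  induction t generalizing x B with
  | zero =>
    by_cases hB : B ∈ Ω
    · simp [patternSurvival, wordSurvival, hB, hΩ _ B h hB]
    · rw [patternSurvival_of_notMem H b 0 hB]
      unfold wordSurvival
      split_ifs <;> norm_num
  | succ t ih =>
    by_cases hB : B ∈ Ω
    · simp only [patternSurvival, wordSurvival, hB, hΩ _ B h hB, if_true]
      rw [sum_glauber_mul]
      refine mul_le_mul_of_nonneg_left (Finset.sum_le_sum fun i _ => ?_) (by positivity)
      have hanti : H.patternSurvival b Ω t (insert i B) ≤ H.patternSurvival b Ω t (B.erase i) :=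
        H.patternSurvival_antitone hb hΩ t
          ((Finset.erase_subset i B).trans (Finset.subset_insert i B))
      rw [flipProb_eq]
      by_cases hi : i ∈ errorSet z x
      -- Here rejection is the outcome that leaves an error at `i`. The energy bound is applied to
      -- the flipped word, whose flip at `i` gives back `x`.
      · have hf := errorSet_flipBit_of_mem hi
        have hsub : errorSet z (flipBit x i) ⊆ B.erase i := by
          rw [hf]; exact Finset.erase_subset_erase i h
        have hE := H.energy_flipBit_sub hz hsub i
        rw [flipBit_flipBit] at hE
        have h1 := one_sub_acceptProb b ((H.energy (flipBit x i) : ℝ) - H.energy x)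
        have h2 : 1 - acceptProb b ((H.energy (flipBit x i) : ℝ) - H.energy x)
            ≤ H.upProb b B i := by
          rw [h1]
          exact acceptProb_antitone hb (by linarith)
        have h3 := convex_comb_le (sub_le_self 1 (acceptProb_nonneg b
          ((H.energy (flipBit x i) : ℝ) - H.energy x))) (sub_nonneg.2 (acceptProb_le_one _ _)) h2
          (ih (h.trans (Finset.subset_insert i B))) (ih hsub) hanti
        linarith
      · have hf := errorSet_flipBit_of_notMem hi
        have hsub : errorSet z x ⊆ B.erase i := Finset.subset_erase.2 ⟨h, hi⟩
        have hE := H.energy_flipBit_sub hz hsub i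
        refine convex_comb_le (acceptProb_le_one _ _) (acceptProb_nonneg _ _)
          (acceptProb_antitone hb hE) (ih ?_) (ih hsub) hanti
        rw [hf]
        exact Finset.insert_subset_insert i h
    · rw [patternSurvival_of_notMem H b _ hB]
      have : ∀ t x, 0 ≤ H.wordSurvival b (fun x => errorSet z x ∈ Ω) t x := by
        intro t
        induction t with
        | zero => intro x; unfold wordSurvival; split_ifs <;> norm_num
        | succ t ih' =>
          intro x
          unfold wordSurvival
          split_ifs
          · rw [sum_glauber_mul]
            refine mul_nonneg (by positivity) (Finset.sum_nonneg fun i _ => ?_)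
            exact add_nonneg (mul_nonneg (acceptProb_nonneg _ _) (ih' _))
              (mul_nonneg (sub_nonneg.2 (acceptProb_le_one _ _)) (ih' _))
          · rfl
      exact this _ _

/-! ### Reversibility and loss through the boundary -/

/-- The Boltzmann weight of an error pattern for `subEnergy`. -/
noncomputable def subWeight (H : ParityCheck m n) (b : ℝ) (B : Finset (Fin n)) : ℝ :=
  Real.exp (-b * H.subEnergy B)

lemma subWeight_pos (H : ParityCheck m n) (b : ℝ) (B : Finset (Fin n)) : 0 < H.subWeight b B :=
  Real.exp_pos _

/-- The patterns outside of `Ω` from which one gets into `Ω` by removing one bit. -/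
def outerBoundary {n : ℕ} (Ω : Finset (Finset (Fin n))) : Finset (Finset (Fin n)) :=
  Finset.univ.filter (fun B => B ∉ Ω ∧ ∃ i ∈ B, B.erase i ∈ Ω)

lemma mem_outerBoundary {Ω : Finset (Finset (Fin n))} {B : Finset (Fin n)} :
    B ∈ outerBoundary Ω ↔ B ∉ Ω ∧ ∃ i ∈ B, B.erase i ∈ Ω := by
  simp [outerBoundary]

/-- One heat bath step at bit `i`, killed outside of `Ω`, as an operator. -/
noncomputable def siteStep (H : ParityCheck m n) (b : ℝ) (g : Finset (Fin n) → ℝ) (i : Fin n)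
    (B : Finset (Fin n)) : ℝ :=
  H.upProb b B i * g (insert i B) + (1 - H.upProb b B i) * g (B.erase i)

lemma sum_finset_eq_sum_pairs (i : Fin n) (f : Finset (Fin n) → ℝ) :
    ∑ B, f B = ∑ B ∈ (Finset.univ.erase i).powerset, (f B + f (insert i B)) := by
  rw [Finset.sum_add_distrib, ← Finset.sum_powerset_insert (Finset.notMem_erase i _),
    Finset.insert_erase (Finset.mem_univ i), Finset.powerset_univ]

/-- Pair `B` with `insert i B`. If both lie in `Ω`, detailed balance conserves the sum. As `Ω` is
downward closed, a pair is split only with the larger set outside; the mass lost is then at most the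
weight of that set, which is on the outer boundary. -/
lemma sum_subWeight_siteStep (H : ParityCheck m n) {b : ℝ}
    {Ω : Finset (Finset (Fin n))} (hΩ : ∀ A B, A ⊆ B → B ∈ Ω → A ∈ Ω)
    {g : Finset (Fin n) → ℝ} (hg1 : ∀ B, g B ≤ 1)
    (hg : ∀ B, B ∉ Ω → g B = 0) (i : Fin n) :
    ∑ B, H.subWeight b B * g B - ∑ B ∈ outerBoundary Ω, H.subWeight b B ≤
      ∑ B, (if B ∈ Ω then H.subWeight b B * H.siteStep b g i B else 0) := by
  have hb : ∑ B ∈ outerBoundary Ω, H.subWeight b B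
      = ∑ B, if B ∈ outerBoundary Ω then H.subWeight b B else 0 := by
    rw [← Finset.sum_filter, Finset.filter_mem_eq_inter, Finset.univ_inter]
  rw [hb, ← Finset.sum_sub_distrib, sum_finset_eq_sum_pairs i,
    sum_finset_eq_sum_pairs i (fun B => if B ∈ Ω then H.subWeight b B * H.siteStep b g i B else 0)]
  refine Finset.sum_le_sum fun B hB => ?_
  have hi : i ∉ B := fun h => Finset.notMem_erase i Finset.univ (Finset.mem_powerset.1 hB h)
  have e0 : B.erase i = B := Finset.erase_eq_of_notMem hi
  have e1 : (insert i B).erase i = B := Finset.erase_insert hi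
  have p0 : H.upProb b B i = acceptProb b (H.subGain B i) := by rw [upProb, e0]
  have p1 : H.upProb b (insert i B) i = acceptProb b (H.subGain B i) := by rw [upProb, e1]
  -- Detailed balance between the two patterns of the pair.
  have hw : H.subWeight b (insert i B) * (1 - acceptProb b (H.subGain B i))
      = H.subWeight b B * acceptProb b (H.subGain B i) := by
    unfold subWeight acceptProb
    rw [H.subEnergy_insert hi, mul_add, Real.exp_add]
    have := Real.exp_pos (-b * H.subGain B i)
    field_simp
    ring
  have hp0 := acceptProb_nonneg b (H.subGain B i)
  have hp1 := acceptProb_le_one b (H.subGain B i)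
  simp only [siteStep, p0, p1, e0, e1, Finset.insert_idem]
  set p := acceptProb b (H.subGain B i)
  have w0 := H.subWeight_pos b B
  have w1 := H.subWeight_pos b (insert i B)
  have k0 : 0 ≤ if B ∈ outerBoundary Ω then H.subWeight b B else 0 := by
    split_ifs <;> linarith
  by_cases h1 : insert i B ∈ Ω
  · have h0 : B ∈ Ω := hΩ _ _ (Finset.subset_insert i B) h1
    have k1 : 0 ≤ if insert i B ∈ outerBoundary Ω then H.subWeight b (insert i B) else 0 := by
      split_ifs <;> linarith
    rw [if_pos h0, if_pos h1]
    have : H.subWeight b B * (p * g (insert i B) + (1 - p) * g B) +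
        H.subWeight b (insert i B) * (p * g (insert i B) + (1 - p) * g B)
        = H.subWeight b B * g B + H.subWeight b (insert i B) * g (insert i B) := by
      linear_combination (g B - g (insert i B)) * hw
    linarith
  · rw [hg _ h1, if_neg h1]
    by_cases h0 : B ∈ Ω
    · have : insert i B ∈ outerBoundary Ω :=
        mem_outerBoundary.2 ⟨h1, i, Finset.mem_insert_self i B, by rwa [e1]⟩
      rw [if_pos h0, if_pos this]
      have h2 : H.subWeight b B * p * g B ≤ H.subWeight b B * p :=
        mul_le_of_le_one_right (by positivity) (hg1 B)
      have h3 : H.subWeight b B * p ≤ H.subWeight b (insert i B) := by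
        rw [← hw]
        exact mul_le_of_le_one_right w1.le (by linarith)
      linarith
    · have k1 : 0 ≤ if insert i B ∈ outerBoundary Ω then H.subWeight b (insert i B) else 0 := by
        split_ifs <;> linarith
      rw [hg _ h0, if_neg h0]
      linarith

lemma patternSurvival_le_one (H : ParityCheck m n) (b : ℝ) (Ω : Finset (Finset (Fin n)))
    (t : ℕ) (B : Finset (Fin n)) : H.patternSurvival b Ω t B ≤ 1 := by
  induction t generalizing B with
  | zero => unfold patternSurvival; split_ifs <;> norm_num
  | succ t ih =>
    unfold patternSurvival
    split_ifs
    · have h1 : ∑ i : Fin n, (H.upProb b B i * H.patternSurvival b Ω t (insert i B) +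
          (1 - H.upProb b B i) * H.patternSurvival b Ω t (B.erase i)) ≤ ∑ _i : Fin n, (1 : ℝ) := by
        refine Finset.sum_le_sum fun i _ => ?_
        have := mul_le_of_le_one_right (acceptProb_nonneg b (H.subGain (B.erase i) i))
          (ih (insert i B))
        have := mul_le_of_le_one_right (sub_nonneg.2
          (acceptProb_le_one b (H.subGain (B.erase i) i))) (ih (B.erase i))
        unfold upProb
        linarith
      rw [Finset.sum_const, Finset.card_univ, Fintype.card_fin, nsmul_eq_mul, mul_one] at h1
      calc _ ≤ (1 / (n : ℝ)) * n := mul_le_mul_of_nonneg_left h1 (by positivity)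
        _ ≤ 1 := by rw [one_div_mul_eq_div]; exact div_self_le_one _
    · norm_num

/-- In the unnormalized equilibrium on `Ω`, averaging `sum_subWeight_siteStep` over the sites shows
that each step loses at most the boundary weight. -/
lemma sum_subWeight_patternSurvival (H : ParityCheck m n) (hn : 0 < n) {b : ℝ}
    {Ω : Finset (Finset (Fin n))} (hΩ : ∀ A B, A ⊆ B → B ∈ Ω → A ∈ Ω) (t : ℕ) :
    ∑ B ∈ Ω, H.subWeight b B - t * ∑ B ∈ outerBoundary Ω, H.subWeight b B ≤
      ∑ B, H.subWeight b B * H.patternSurvival b Ω t B := by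
  induction t with
  | zero => simp [patternSurvival]
  | succ t ih =>
    have h := fun i => H.sum_subWeight_siteStep (b := b) hΩ
      (H.patternSurvival_le_one b Ω t)
      (fun B hB => H.patternSurvival_of_notMem b t hB) i
    have hsum := Finset.sum_le_sum (s := Finset.univ) fun i _ => h i
    rw [Finset.sum_const, Finset.card_univ, Fintype.card_fin, nsmul_eq_mul] at hsum
    have hn' : (0 : ℝ) < n := by exact_mod_cast hn
    have e : ∑ B, H.subWeight b B * H.patternSurvival b Ω (t + 1) B
        = (1 / (n : ℝ)) * ∑ i : Fin n, ∑ B, (if B ∈ Ω then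
            H.subWeight b B * H.siteStep b (H.patternSurvival b Ω t) i B else 0) := by
      rw [Finset.sum_comm, Finset.mul_sum]
      refine Finset.sum_congr rfl fun B _ => ?_
      by_cases hB : B ∈ Ω
      · simp only [patternSurvival, hB, if_true, siteStep, ← Finset.mul_sum]
        ring
      · simp [patternSurvival, hB]
    rw [e, one_div_mul_eq_div, le_div_iff₀ hn']
    push_cast
    nlinarith

/-- Starting without errors is better than starting in equilibrium inside `Ω`. -/
lemma le_patternSurvival_empty (H : ParityCheck m n) (hn : 0 < n) {b : ℝ} (hb : 0 ≤ b)
    {Ω : Finset (Finset (Fin n))} (hΩ : ∀ A B, A ⊆ B → B ∈ Ω → A ∈ Ω) (t : ℕ) {ε : ℝ}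
    (hε : ∑ B ∈ outerBoundary Ω, H.subWeight b B ≤ ε * ∑ B ∈ Ω, H.subWeight b B)
    (h0 : ∅ ∈ Ω) : 1 - t * ε ≤ H.patternSurvival b Ω t ∅ := by
  have h1 := H.sum_subWeight_patternSurvival hn (b := b) hΩ t
  have h2 : ∑ B, H.subWeight b B * H.patternSurvival b Ω t B
      ≤ (∑ B ∈ Ω, H.subWeight b B) * H.patternSurvival b Ω t ∅ := by
    rw [Finset.sum_mul, ← Finset.sum_subset (Finset.subset_univ Ω)]
    · exact Finset.sum_le_sum fun B _ => mul_le_mul_of_nonneg_left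
        (H.patternSurvival_antitone hb hΩ t (Finset.empty_subset B)) (H.subWeight_pos b B).le
    · intro B _ hB
      rw [H.patternSurvival_of_notMem b t hB, mul_zero]
  have hZ : 0 < ∑ B ∈ Ω, H.subWeight b B :=
    Finset.sum_pos (fun B _ => H.subWeight_pos b B) ⟨∅, h0⟩
  have h3 : (t : ℝ) * ∑ B ∈ outerBoundary Ω, H.subWeight b B
      ≤ t * (ε * ∑ B ∈ Ω, H.subWeight b B) := mul_le_mul_of_nonneg_left hε (by positivity)
  refine le_of_mul_le_mul_left ?_ hZ
  linarith

/-! ### Trajectories -/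

lemma flipProb_nonneg (H : ParityCheck m n) (b : ℝ) (x : Word n) (i : Fin n) :
    0 ≤ H.flipProb b x i := acceptProb_nonneg _ _

lemma flipProb_le_one (H : ParityCheck m n) (b : ℝ) (x : Word n) (i : Fin n) :
    H.flipProb b x i ≤ 1 := acceptProb_le_one _ _

lemma glauber_nonneg (H : ParityCheck m n) (b : ℝ) (x y : Word n) : 0 ≤ H.glauber b x y := by
  unfold glauber
  refine mul_nonneg (by positivity) (Finset.sum_nonneg fun i _ => ?_)
  have h0 := H.flipProb_nonneg b x i
  have h1 := H.flipProb_le_one b x i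
  refine add_nonneg (mul_nonneg h0 (by split_ifs <;> norm_num))
    (mul_nonneg (by linarith) (by split_ifs <;> norm_num))

lemma trajectoryProb_nonneg (H : ParityCheck m n) (b : ℝ) (z : Word n) (t : ℕ)
    (ω : Fin (t + 1) → Word n) : 0 ≤ H.trajectoryProb b z t ω := by
  unfold trajectoryProb
  refine mul_nonneg (by split_ifs <;> norm_num) (Finset.prod_nonneg fun s _ => ?_)
  exact H.glauber_nonneg b _ _

lemma trajectoryProb_cons (H : ParityCheck m n) (b : ℝ) (z y : Word n) (t : ℕ)
    (ω : Fin (t + 1) → Word n) :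
    H.trajectoryProb b z (t + 1) (Fin.cons y ω) =
      (if y = z then 1 else 0) * (H.glauber b y (ω 0) * H.trajectoryProb b (ω 0) t ω) := by
  unfold trajectoryProb
  rw [Fin.prod_univ_succ]
  simp [Fin.castSucc_succ]

lemma trajectoryProb_of_ne (H : ParityCheck m n) (b : ℝ) {z : Word n} {t : ℕ}
    {ω : Fin (t + 1) → Word n} (h : ω 0 ≠ z) : H.trajectoryProb b z t ω = 0 := by
  rw [trajectoryProb, if_neg h, zero_mul]

open Classical in
-- First-step decomposition: splitting off the initial word turns the sum over trajectories into the
-- recursion of `wordSurvival`.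
lemma sum_trajectoryProb_mem (H : ParityCheck m n) (b : ℝ) (G : Word n → Prop) (t : ℕ)
    (z : Word n) :
    ∑ ω : Fin (t + 1) → Word n, (if ∀ s, G (ω s) then H.trajectoryProb b z t ω else 0)
      = H.wordSurvival b G t z := by
  induction t generalizing z with
  | zero =>
    rw [← (Equiv.funUnique (Fin 1) (Word n)).symm.sum_comp, Finset.sum_eq_single z]
    · simp [trajectoryProb, wordSurvival]
    · intro y _ hy
      rw [trajectoryProb_of_ne H b (by simpa using hy), ite_self]
    · simp
  | succ t ih =>
    rw [← (Fin.consEquiv (fun _ : Fin (t + 2) => Word n)).sum_comp, Fintype.sum_prod_type,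
      Finset.sum_eq_single z]
    -- A sum over the start `y` of the tail is introduced so that the induction hypothesis applies;
    -- only `y = ω 0` contributes.
    · have hsplit : ∀ ω : Fin (t + 1) → Word n,
          (if ∀ s, G (ω s) then H.glauber b z (ω 0) * H.trajectoryProb b (ω 0) t ω else 0)
            = ∑ y, H.glauber b z y *
              (if ∀ s, G (ω s) then H.trajectoryProb b y t ω else 0) := by
        intro ω
        rw [Finset.sum_eq_single (ω 0)]
        · split_ifs <;> simp
        · intro y _ hy
          rw [trajectoryProb_of_ne H b hy.symm, ite_self, mul_zero]
        · simp
      by_cases hz : G z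
      · simp only [wordSurvival, hz, if_true, ← ih, Finset.mul_sum]
        rw [Finset.sum_comm]
        refine Finset.sum_congr rfl fun ω _ => ?_
        rw [← hsplit]
        change (if ∀ s, G ((Fin.cons z ω : Fin (t + 2) → Word n) s) then
          H.trajectoryProb b z (t + 1) (Fin.cons z ω) else 0) = _
        rw [trajectoryProb_cons]
        simp [Fin.forall_fin_succ, hz]
      · rw [wordSurvival, if_neg hz]
        refine Finset.sum_eq_zero fun ω _ => if_neg fun h => hz ?_
        exact h 0
    · intro y _ hy
      refine Finset.sum_eq_zero fun ω _ => ?_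
      rw [trajectoryProb_of_ne H b, ite_self]
      exact hy
    · simp

lemma sum_glauber (H : ParityCheck m n) (hn : 0 < n) (b : ℝ) (x : Word n) :
    ∑ y, H.glauber b x y = 1 := by
  have h := H.sum_glauber_mul b x (fun _ => 1)
  simp only [mul_one, add_sub_cancel, Finset.sum_const, Finset.card_univ, Fintype.card_fin,
    nsmul_eq_mul] at h
  rw [h]
  have : (n : ℝ) ≠ 0 := by exact_mod_cast hn.ne'
  field_simp

lemma sum_trajectoryProb (H : ParityCheck m n) (hn : 0 < n) (b : ℝ) (t : ℕ) (z : Word n) :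
    ∑ ω, H.trajectoryProb b z t ω = 1 := by
  have h : ∀ t z, H.wordSurvival b (fun _ => True) t z = 1 := by
    intro t
    induction t with
    | zero => intro z; simp [wordSurvival]
    | succ t ih => intro z; simp [wordSurvival, ih, H.sum_glauber hn]
  rw [← h t z, ← sum_trajectoryProb_mem]
  simp

lemma memoryFailureProb_le (H : ParityCheck m n) (hn : 0 < n) (b : ℝ) (D : H.Decoder)
    (z : Word n) (t : ℕ) {G : Word n → Prop} (hG : ∀ x, G x → D.toFun x = z) :
    H.memoryFailureProb b D z t ≤ 1 - H.wordSurvival b G t z := by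
  classical
  rw [← H.sum_trajectoryProb hn b t z, ← sum_trajectoryProb_mem, ← Finset.sum_sub_distrib]
  refine Finset.sum_le_sum fun ω _ => ?_
  have := H.trajectoryProb_nonneg b z t ω
  by_cases h : ∀ s, G (ω s)
  · rw [if_neg, if_pos h, sub_self]
    rintro ⟨s, hs⟩
    exact hs (hG _ (h s))
  · rw [if_neg h, sub_zero]
    split_ifs <;> linarith

/-! ### Connected sets -/

section Animals

variable {V : Type*} {nb : V → Finset V}

open Classical in
/-- The connected component of `j` within `x`. -/
noncomputable def component (nb : V → Finset V) (x : Finset V) (j : V) : Finset V :=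
  x.filter fun k => Relation.ReflTransGen (fun a c => c ∈ nb a ∧ c ∈ x) j k

lemma mem_component {x : Finset V} {j k : V} : k ∈ component nb x j ↔
    k ∈ x ∧ Relation.ReflTransGen (fun a c => c ∈ nb a ∧ c ∈ x) j k := by
  simp [component]

lemma component_subset (x : Finset V) (j : V) : component nb x j ⊆ x :=
  fun _ h => (mem_component.1 h).1

lemma self_mem_component {x : Finset V} {j : V} (hj : j ∈ x) : j ∈ component nb x j :=
  mem_component.2 ⟨hj, .refl⟩

lemma mem_component_of_mem_nb {x : Finset V} {j k l : V} (hk : k ∈ component nb x j)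
    (hl : l ∈ nb k) (hx : l ∈ x) : l ∈ component nb x j :=
  mem_component.2 ⟨hx, (mem_component.1 hk).2.tail ⟨hl, hx⟩⟩

variable [DecidableEq V]

/-- The nonempty finite sets of vertices that are connected in the graph in which `nb i` is the set
of neighbours of `i`. -/
inductive IsAnimal (nb : V → Finset V) : Finset V → Prop
  | singleton (i : V) : IsAnimal nb {i}
  | cons {S : Finset V} {i j : V} (hS : IsAnimal nb S) (hi : i ∈ S) (hj : j ∈ nb i) :
      IsAnimal nb (insert j S)

/-- The walks with `ℓ` steps that start in `v`. -/
def walks (nb : V → Finset V) : ℕ → V → Finset (List V)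
  | 0, v => {[v]}
  | ℓ + 1, v => (nb v).biUnion fun u => (walks nb ℓ u).image (List.cons v)

lemma mem_walks_succ {ℓ : ℕ} {v : V} {L : List V} :
    L ∈ walks nb (ℓ + 1) v ↔ ∃ u ∈ nb v, ∃ L' ∈ walks nb ℓ u, v :: L' = L := by
  simp [walks]

lemma card_walks_le {Δ : ℕ} (hΔ : ∀ i, (nb i).card ≤ Δ) (ℓ : ℕ) (v : V) :
    (walks nb ℓ v).card ≤ Δ ^ ℓ := by
  induction ℓ generalizing v with
  | zero => simp [walks]
  | succ ℓ ih =>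
    rw [walks, pow_succ']
    refine (Finset.card_biUnion_le_card_mul _ _ (Δ ^ ℓ) fun u _ => ?_).trans
      (Nat.mul_le_mul_right _ (hΔ v))
    exact Finset.card_image_le.trans (ih u)

lemma length_of_mem_walks {ℓ : ℕ} {v : V} {L : List V} (hL : L ∈ walks nb ℓ v) :
    L.length = ℓ + 1 := by
  induction ℓ generalizing v L with
  | zero => simp [walks] at hL; simp [hL]
  | succ ℓ ih =>
    obtain ⟨u, _, L', hL', rfl⟩ := mem_walks_succ.1 hL
    simp [ih hL']

lemma head_mem_of_mem_walks {ℓ : ℕ} {v : V} {L : List V} (hL : L ∈ walks nb ℓ v) : v ∈ L := by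
  cases ℓ with
  | zero => simp [walks] at hL; simp [hL]
  | succ ℓ =>
    obtain ⟨u, _, L', hL', rfl⟩ := mem_walks_succ.1 hL
    simp

/-- A walk through `i` can make a detour to a neighbour `j` of `i`. -/
lemma exists_walk_insert (hsymm : ∀ i j, j ∈ nb i → i ∈ nb j) {ℓ : ℕ} {v i j : V} {L : List V}
    (hL : L ∈ walks nb ℓ v) (hi : i ∈ L) (hj : j ∈ nb i) :
    ∃ L' ∈ walks nb (ℓ + 2) v, L'.toFinset = insert j L.toFinset := by
  have key : ∀ {ℓ : ℕ} {L : List V}, L ∈ walks nb ℓ i →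
      ∃ L' ∈ walks nb (ℓ + 2) i, L'.toFinset = insert j L.toFinset := by
    intro ℓ L hL
    refine ⟨i :: j :: L, mem_walks_succ.2 ⟨j, hj, j :: L,
      mem_walks_succ.2 ⟨i, hsymm i j hj, L, hL, rfl⟩, rfl⟩, ?_⟩
    have := head_mem_of_mem_walks hL
    ext k
    simp only [List.mem_toFinset, List.mem_cons, Finset.mem_insert]
    constructor
    · rintro (rfl | h)
      · exact Or.inr this
      · exact h
    · exact Or.inr
  induction ℓ generalizing v L with
  | zero =>
    have : i = v := by
      simp only [walks, Finset.mem_singleton] at hL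
      simpa [hL] using hi
    subst this
    exact key hL
  | succ ℓ ih =>
    by_cases hv : i = v
    · subst hv
      exact key hL
    · obtain ⟨u, hu, L₁, hL₁, rfl⟩ := mem_walks_succ.1 hL
      obtain ⟨L', hL', e⟩ := ih hL₁ ((List.mem_cons.1 hi).resolve_left hv)
      refine ⟨v :: L', mem_walks_succ.2 ⟨u, hu, L', hL', rfl⟩, ?_⟩
      rw [List.toFinset_cons, e, List.toFinset_cons, Finset.insert_comm]

/-- Each new vertex costs a detour of two steps, whence the length `2 * W.card`; the loops given by
`hrefl` pad a walk to any larger length. -/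
lemma IsAnimal.exists_walk (hrefl : ∀ i, i ∈ nb i) (hsymm : ∀ i j, j ∈ nb i → i ∈ nb j)
    {W : Finset V} (hW : IsAnimal nb W) {ℓ : ℕ} (hℓ : 2 * W.card ≤ ℓ) :
    ∃ v, ∃ L ∈ walks nb ℓ v, L.toFinset = W := by
  have pad : ∀ {k ℓ : ℕ} {W : Finset V}, k ≤ ℓ → (∃ v, ∃ L ∈ walks nb k v, L.toFinset = W) →
      ∃ v, ∃ L ∈ walks nb ℓ v, L.toFinset = W := by
    intro k ℓ W hk h
    induction ℓ, hk using Nat.le_induction with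
    | base => exact h
    | succ ℓ _ ih =>
      obtain ⟨v, L, hL, rfl⟩ := ih
      refine ⟨v, v :: L, mem_walks_succ.2 ⟨v, hrefl v, L, hL, rfl⟩, ?_⟩
      rw [List.toFinset_cons,
        Finset.insert_eq_of_mem (List.mem_toFinset.2 (head_mem_of_mem_walks hL))]
  refine pad hℓ ?_
  clear hℓ
  induction hW with
  | singleton i => exact pad (Nat.zero_le _) ⟨i, [i], by simp [walks], by simp⟩
  | @cons S i j hS hi hj ih =>
    by_cases hjS : j ∈ S
    · rwa [Finset.insert_eq_of_mem hjS]
    · obtain ⟨v, L, hL, rfl⟩ := ih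
      obtain ⟨L', hL', e⟩ := exists_walk_insert hsymm hL (List.mem_toFinset.1 hi) hj
      rw [Finset.card_insert_of_notMem hjS]
      exact ⟨v, L', hL', e⟩

/-- The number of sets that are contained in a connected set of `k` vertices at most. -/
lemma card_subsets_animals_le [Fintype V] {Δ : ℕ} (hΔ : ∀ i, (nb i).card ≤ Δ)
    (hrefl : ∀ i, i ∈ nb i) (hsymm : ∀ i j, j ∈ nb i → i ∈ nb j) {k : ℕ} {F : Finset (Finset V)}
    (hF : ∀ U ∈ F, ∃ W, IsAnimal nb W ∧ U ⊆ W ∧ W.card ≤ k) :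
    F.card ≤ Fintype.card V * (Δ ^ (2 * k) * 2 ^ (2 * k + 1)) := by
  have hsub : F ⊆ (Finset.univ : Finset V).biUnion fun v =>
      (walks nb (2 * k) v).biUnion fun L => L.toFinset.powerset := by
    intro U hU
    obtain ⟨W, hW, hUW, hk⟩ := hF U hU
    obtain ⟨v, L, hL, rfl⟩ := hW.exists_walk hrefl hsymm (Nat.mul_le_mul_left 2 hk)
    exact Finset.mem_biUnion.2 ⟨v, Finset.mem_univ v, Finset.mem_biUnion.2
      ⟨L, hL, Finset.mem_powerset.2 hUW⟩⟩
  refine (Finset.card_le_card hsub).trans (Finset.card_biUnion_le_card_mul _ _ _ fun v _ => ?_)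
  refine (Finset.card_biUnion_le_card_mul _ _ (2 ^ (2 * k + 1)) fun L hL => ?_).trans
    (Nat.mul_le_mul_right _ (card_walks_le hΔ _ v))
  rw [Finset.card_powerset]
  refine Nat.pow_le_pow_right (by norm_num) ?_
  rw [← length_of_mem_walks hL]
  exact L.toFinset_card_le

/-- Greedy growth by one vertex at a time: `h` says that no intermediate connected set is stuck
inside `V₀` before it reaches size `k`. -/
lemma IsAnimal.exists_superset {T₀ V₀ : Finset V} (h₀ : IsAnimal nb T₀) (hsub : T₀ ⊆ V₀) {k : ℕ}
    (hk : T₀.card ≤ k)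
    (h : ∀ T, IsAnimal nb T → T₀ ⊆ T → T ⊆ V₀ → T.card < k → ∃ i ∈ T, ∃ j ∈ V₀ \ T, j ∈ nb i) :
    ∃ T, IsAnimal nb T ∧ T₀ ⊆ T ∧ T ⊆ V₀ ∧ T.card = k := by
  induction k, hk using Nat.le_induction with
  | base => exact ⟨T₀, h₀, subset_rfl, hsub, rfl⟩
  | succ k _ ih =>
    obtain ⟨T, hT, h1, h2, rfl⟩ := ih fun T hT h1 h2 h3 =>
      h T hT h1 h2 (h3.trans (Nat.lt_succ_self _))
    obtain ⟨i, hi, j, hj, hij⟩ := h T hT h1 h2 (Nat.lt_succ_self _)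
    rw [Finset.mem_sdiff] at hj
    exact ⟨insert j T, hT.cons hi hij, h1.trans (Finset.subset_insert j T),
      Finset.insert_subset hj.1 h2, Finset.card_insert_of_notMem hj.2⟩

lemma exists_edge_of_mem_component {x T : Finset V} {j k : V} (hj : j ∈ T)
    (hk : k ∈ component nb x j) (hkT : k ∉ T) :
    ∃ i ∈ T, ∃ l ∈ component nb x j \ T, l ∈ nb i := by
  obtain ⟨_, hpath⟩ := mem_component.1 hk
  clear hk
  induction hpath with
  | refl => exact absurd hj hkT
  | @tail a c ha hac ih =>
    by_cases haT : a ∈ T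
    · exact ⟨a, haT, c, Finset.mem_sdiff.2 ⟨mem_component.2 ⟨hac.2, ha.tail hac⟩, hkT⟩, hac.1⟩
    · refine ih haT ?_
      induction ha with
      | refl => exact absurd hj haT
      | tail _ h => exact h.2

lemma exists_animal_subset_component {x : Finset V} {j : V} (hj : j ∈ x) {k : ℕ} (hk0 : 1 ≤ k)
    (hk : k ≤ (component nb x j).card) :
    ∃ T, IsAnimal nb T ∧ T ⊆ component nb x j ∧ T.card = k := by
  obtain ⟨T, h1, _, h2, h3⟩ := (IsAnimal.singleton (nb := nb) j).exists_superset
    (Finset.singleton_subset_iff.2 (self_mem_component hj)) (k := k) (by simpa using hk0) (by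
      intro T _ hjT hT hcard
      obtain ⟨l, hl, hlT⟩ := Finset.exists_mem_notMem_of_card_lt_card (hcard.trans_le hk)
      exact exists_edge_of_mem_component (Finset.singleton_subset_iff.1 hjT) hl hlT)
  exact ⟨T, h1, h2, h3⟩

lemma IsAnimal.union_component {S x : Finset V} (hS : IsAnimal nb S) {i j : V} (hi : i ∈ S)
    (hj : j ∈ nb i) (hx : j ∈ x) : IsAnimal nb (S ∪ component nb x j) := by
  obtain ⟨T, h1, _, h2, h3⟩ := hS.exists_superset
    (Finset.subset_union_left (s₂ := component nb x j)) (k := (S ∪ component nb x j).card)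
    (Finset.card_le_card Finset.subset_union_left) (by
      intro T _ hST hT hcard
      by_cases hjT : j ∈ T
      · obtain ⟨l, hl, hlT⟩ := Finset.exists_mem_notMem_of_card_lt_card hcard
        have hl' : l ∈ component nb x j :=
          (Finset.mem_union.1 hl).resolve_left fun h => hlT (hST h)
        obtain ⟨a, ha, c, hc, hac⟩ := exists_edge_of_mem_component hjT hl' hlT
        exact ⟨a, ha, c, Finset.sdiff_subset_sdiff Finset.subset_union_right le_rfl hc, hac⟩
      · exact ⟨i, hST hi, j, Finset.mem_sdiff.2
          ⟨Finset.mem_union_right _ (self_mem_component hx), hjT⟩, hj⟩)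
  rwa [Finset.eq_of_subset_of_card_le h2 h3.ge] at h1

lemma IsAnimal.union_biUnion_component {S x J : Finset V} (hS : IsAnimal nb S)
    (hJ : ∀ j ∈ J, j ∈ x ∧ ∃ i ∈ S, j ∈ nb i) :
    IsAnimal nb (S ∪ J.biUnion (component nb x)) := by
  induction J using Finset.induction_on with
  | empty => simpa using hS
  | @insert j J _ ih =>
    obtain ⟨hx, i, hi, hj⟩ := hJ j (Finset.mem_insert_self j J)
    rw [Finset.biUnion_insert, Finset.union_comm (component nb x j), ← Finset.union_assoc]
    exact (ih fun k hk => hJ k (Finset.mem_insert_of_mem hk)).union_component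
      (Finset.mem_union_left _ hi) hj hx

/-! ### Sets that are sparse on all connected sets -/

variable [Fintype V]

open Classical in
/-- The sets that contain less than half of each connected set of `s` vertices. -/
noncomputable def sparseSets (nb : V → Finset V) (s : ℕ) : Finset (Finset V) :=
  Finset.univ.filter fun A => ∀ S, IsAnimal nb S → S.card = s → 2 * (A ∩ S).card < s

lemma mem_sparseSets {s : ℕ} {A : Finset V} :
    A ∈ sparseSets nb s ↔ ∀ S, IsAnimal nb S → S.card = s → 2 * (A ∩ S).card < s := by
  simp [sparseSets]

lemma sparseSets_mono {s : ℕ} (A B : Finset V) (h : A ⊆ B) (hB : B ∈ sparseSets nb s) :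
    A ∈ sparseSets nb s :=
  mem_sparseSets.2 fun S hS hs => (Nat.mul_le_mul_left 2
    (Finset.card_le_card (Finset.inter_subset_inter_right h))).trans_lt (mem_sparseSets.1 hB S hS hs)

lemma empty_mem_sparseSets {s : ℕ} (hs : 0 < s) : ∅ ∈ sparseSets nb s :=
  mem_sparseSets.2 fun S _ _ => by simpa using hs

/-- A component with `s` or more vertices would contain a connected set of exactly `s` vertices,
lying wholly in `x`. -/
lemma card_component_lt {s : ℕ} (hs : 0 < s) {x : Finset V} (hx : x ∈ sparseSets nb s) {j : V}
    (hj : j ∈ x) : (component nb x j).card < s := by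
  by_contra! h
  obtain ⟨T, hT, hTx, hTs⟩ := exists_animal_subset_component hj hs h
  have := mem_sparseSets.1 hx T hT hTs
  rw [Finset.inter_eq_right.2 (hTx.trans (component_subset x j)), hTs] at this
  omega

/-- A set `y` on the outer boundary of the sparse sets splits off a part `U` of moderate size which
no edge joins to the rest of `y`. -/
lemma exists_separated_part (hrefl : ∀ i, i ∈ nb i) {Δ : ℕ} (hΔ : ∀ i, (nb i).card ≤ Δ) {s : ℕ}
    (hs : 0 < s) {y : Finset V} (hy : y ∉ sparseSets nb s) {i : V} (hi : i ∈ y)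
    (hx : y.erase i ∈ sparseSets nb s) :
    ∃ U ⊆ y, i ∈ U ∧ (∀ u ∈ U, ∀ v ∈ y, v ∈ nb u → v ∈ U) ∧ s ≤ 2 * U.card ∧
      U.card ≤ 1 + (Δ + 2) * s ∧ ∃ W, IsAnimal nb W ∧ U ⊆ W ∧ W.card ≤ 3 * U.card := by
  classical
  set x := y.erase i with hxdef
  have hxy : x ⊆ y := Finset.erase_subset i y
  obtain ⟨S, hS, hSs, hSy⟩ : ∃ S, IsAnimal nb S ∧ S.card = s ∧ s ≤ 2 * (y ∩ S).card := by
    simpa [mem_sparseSets] using hy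
  -- Removing `i` restores sparseness, so every violated connected set contains `i`.
  have hiS : i ∈ S := by
    by_contra hiS
    have h1 : y ∩ S = x ∩ S := by
      ext k
      simp only [hxdef, Finset.mem_inter, Finset.mem_erase]
      grind
    have := mem_sparseSets.1 hx S hS hSs
    rw [← h1] at this
    omega
  let N := nb i ∩ x
  -- `i` together with whole components of `x`, among them all those adjacent to `i`; such a set is
  -- closed under adjacency in `y` for every `J`.
  let u : Finset V → Finset V := fun J => insert i ((N ∪ J).biUnion (component nb x))
  let 𝒥 := (S ∩ x).powerset.filter fun J => s ≤ 2 * (u J).card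
  have hne : 𝒥.Nonempty := by
    refine ⟨S ∩ x, Finset.mem_filter.2 ⟨Finset.mem_powerset_self _, hSy.trans ?_⟩⟩
    refine Nat.mul_le_mul_left 2 (Finset.card_le_card fun k hk => ?_)
    obtain ⟨hky, hkS⟩ := Finset.mem_inter.1 hk
    by_cases hki : k = i
    · exact Finset.mem_insert.2 (Or.inl hki)
    · have hkx : k ∈ x := Finset.mem_erase.2 ⟨hki, hky⟩
      exact Finset.mem_insert_of_mem (Finset.mem_biUnion.2
        ⟨k, Finset.mem_union_right _ (Finset.mem_inter.2 ⟨hkS, hkx⟩), self_mem_component hkx⟩)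
  -- Minimality keeps `u J` from being too large: without one element of `J` it drops below `s / 2`,
  -- and that element restores one component, of size less than `s`. If `J` is empty, there are at
  -- most `Δ` components.
  obtain ⟨J, hJ, hmin⟩ := Finset.exists_min_image 𝒥 Finset.card hne
  obtain ⟨hJS, hJs⟩ := Finset.mem_filter.1 hJ
  rw [Finset.mem_powerset] at hJS
  have hNJ : ∀ j ∈ N ∪ J, j ∈ x ∧ ∃ k ∈ S, j ∈ nb k := by
    intro j hj
    rcases Finset.mem_union.1 hj with hj | hj
    · exact ⟨(Finset.mem_inter.1 hj).2, i, hiS, (Finset.mem_inter.1 hj).1⟩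
    · have := Finset.mem_inter.1 (hJS hj)
      exact ⟨this.2, j, this.1, hrefl j⟩
  refine ⟨u J, ?_, Finset.mem_insert_self _ _, ?_, hJs, ?_, S ∪ u J, ?_,
    Finset.subset_union_right, ?_⟩
  · refine Finset.insert_subset hi (Finset.biUnion_subset.2 fun j _ => ?_)
    exact (component_subset x j).trans hxy
  · intro a ha v hv hva
    by_cases hvi : v = i
    · exact Finset.mem_insert.2 (Or.inl hvi)
    · have hvx : v ∈ x := Finset.mem_erase.2 ⟨hvi, hv⟩
      refine Finset.mem_insert_of_mem (Finset.mem_biUnion.2 ?_)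
      rcases Finset.mem_insert.1 ha with rfl | ha
      · exact ⟨v, Finset.mem_union_left _ (Finset.mem_inter.2 ⟨hva, hvx⟩), self_mem_component hvx⟩
      · obtain ⟨j, hj, haj⟩ := Finset.mem_biUnion.1 ha
        exact ⟨j, hj, mem_component_of_mem_nb haj hva hvx⟩
  · rcases J.eq_empty_or_nonempty with rfl | ⟨j, hj⟩
    · have h1 : ((N ∪ ∅).biUnion (component nb x)).card ≤ N.card * s := by
        rw [Finset.union_empty]
        exact Finset.card_biUnion_le_card_mul _ _ _ fun j hj =>
          (card_component_lt hs hx (Finset.mem_inter.1 hj).2).le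
      have h2 : N.card ≤ Δ := (Finset.card_le_card Finset.inter_subset_left).trans (hΔ i)
      have h3 := Finset.card_insert_le i ((N ∪ ∅).biUnion (component nb x))
      have h4 := Nat.mul_le_mul_right s h2
      have h5 : (u ∅).card ≤ N.card * s + 1 := h3.trans (by omega)
      linarith
    · have h1 : 2 * (u (J.erase j)).card < s := by
        by_contra! h
        have := hmin (J.erase j) (Finset.mem_filter.2
          ⟨Finset.mem_powerset.2 ((Finset.erase_subset j J).trans hJS), h⟩)
        exact absurd this (not_le.2 (Finset.card_erase_lt_of_mem hj))
      have h2 : u J ⊆ u (J.erase j) ∪ component nb x j := by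
        intro k hk
        rcases Finset.mem_insert.1 hk with rfl | hk
        · exact Finset.mem_union_left _ (Finset.mem_insert_self _ _)
        · obtain ⟨l, hl, hkl⟩ := Finset.mem_biUnion.1 hk
          by_cases hlj : l = j
          · subst hlj
            exact Finset.mem_union_right _ hkl
          · refine Finset.mem_union_left _ (Finset.mem_insert_of_mem
              (Finset.mem_biUnion.2 ⟨l, ?_, hkl⟩))
            grind
      have h3 := (Finset.card_le_card h2).trans (Finset.card_union_le _ _)
      have h4 := card_component_lt hs hx (Finset.mem_inter.1 (hJS hj)).2
      have : 0 ≤ Δ * s := Nat.zero_le _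
      linarith
  · have : S ∪ u J = S ∪ (N ∪ J).biUnion (component nb x) := by
      rw [Finset.union_insert, Finset.insert_eq_of_mem (Finset.mem_union_left _ hiS)]
    rw [this]
    exact hS.union_biUnion_component hNJ
  -- The factor 3 comes from `S.card = s ≤ 2 * (u J).card`.
  · have := Finset.card_union_le S (u J)
    omega

end Animals

/-! ### The adjacency graph of the bits -/

open Classical in
/-- The bits that share a check with bit `i`, and `i` itself. -/
noncomputable def nbhd (H : ParityCheck m n) (i : Fin n) : Finset (Fin n) :=
  insert i ((H.checks i).biUnion fun r => Finset.univ.filter fun l => H.TannerAdj l r)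

lemma mem_nbhd (H : ParityCheck m n) (i j : Fin n) :
    j ∈ H.nbhd i ↔ j = i ∨ ∃ r, H.TannerAdj i r ∧ H.TannerAdj j r := by
  simp [nbhd, mem_checks]

lemma self_mem_nbhd (H : ParityCheck m n) (i : Fin n) : i ∈ H.nbhd i :=
  (H.mem_nbhd i i).2 (Or.inl rfl)

lemma nbhd_symm (H : ParityCheck m n) (i j : Fin n) (h : j ∈ H.nbhd i) : i ∈ H.nbhd j := by
  rw [mem_nbhd] at h ⊢
  grind

lemma card_nbhd_le (H : ParityCheck m n) {wbit wcheck : ℕ} (hdeg : H.DegreeBounded wbit wcheck)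
    (i : Fin n) : (H.nbhd i).card ≤ wbit * wcheck + 1 := by
  classical
  refine (Finset.card_insert_le _ _).trans (Nat.add_le_add_right ?_ 1)
  refine (Finset.card_biUnion_le_card_mul _ _ wcheck fun r _ => ?_).trans
    (Nat.mul_le_mul_right _ ?_)
  · convert hdeg.2 r
  · have := hdeg.1 i
    unfold checks
    convert this

lemma disjoint_neighborSet_sdiff (H : ParityCheck m n) {U y : Finset (Fin n)}
    (h : ∀ u ∈ U, ∀ v ∈ y, v ∈ H.nbhd u → v ∈ U) :
    Disjoint (H.neighborSet U) (H.neighborSet (y \ U)) := by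
  rw [Finset.disjoint_left]
  intro r hU hR
  obtain ⟨u, hu, hur⟩ := (H.mem_neighborSet _ _).1 hU
  obtain ⟨v, hv, hvr⟩ := (H.mem_neighborSet _ _).1 hR
  rw [Finset.mem_sdiff] at hv
  exact hv.2 (h u hu v hv.1 ((H.mem_nbhd u v).2 (Or.inr ⟨r, hur, hvr⟩)))

/-! ### The Peierls bound -/

/-- Energy against entropy at each size $k=|U|$. Walks of length $6k$ and their subsets give at most
$2n(64\Delta^6)^k$ sets, each of weight at most $e^{-b(2\gamma-w_{\rm bit})k}$. By `hcold` the total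
is at most $2ne^{-2k}\le 2ne^{-s}$, and there are $n+1$ sizes. -/
lemma sum_subWeight_le (H : ParityCheck m n) {wbit wcheck : ℕ} {δ γ b : ℝ}
    (hdeg : H.DegreeBounded wbit wcheck) (hexp : H.IsLeftExpander δ γ) (hb : 0 ≤ b) {s : ℕ}
    (hcold : 64 * ((wbit * wcheck + 1 : ℕ) : ℝ) ^ 6 * Real.exp (-b * (2 * γ - wbit))
      ≤ Real.exp (-2)) {F : Finset (Finset (Fin n))}
    (hF : ∀ U ∈ F, s ≤ 2 * U.card ∧ (U.card : ℝ) ≤ δ ∧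
      ∃ W, IsAnimal H.nbhd W ∧ U ⊆ W ∧ W.card ≤ 3 * U.card) :
    ∑ U ∈ F, H.subWeight b U ≤ 2 * n * (n + 1) * Real.exp (-s) := by
  classical
  set Δ := wbit * wcheck + 1 with hΔ
  rw [← Finset.sum_fiberwise_of_maps_to (s := F) (t := Finset.range (n + 1)) (g := Finset.card)
    fun U _ => Finset.mem_range.2 (Nat.lt_succ_of_le (by simpa using U.card_le_univ))]
  have key : ∀ k ∈ Finset.range (n + 1),
      ∑ U ∈ F.filter (fun U => U.card = k), H.subWeight b U ≤ 2 * n * Real.exp (-s) := by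
    intro k _
    rcases (F.filter fun U => U.card = k).eq_empty_or_nonempty with h0 | ⟨U₀, hU₀⟩
    · rw [h0, Finset.sum_empty]
      positivity
    have hsk : s ≤ 2 * k := by
      obtain ⟨h1, h2⟩ := Finset.mem_filter.1 hU₀
      rw [← h2]
      exact (hF U₀ h1).1
    have hcard : (F.filter fun U => U.card = k).card ≤
        n * (Δ ^ (2 * (3 * k)) * 2 ^ (2 * (3 * k) + 1)) := by
      have := card_subsets_animals_le (F := F.filter fun U => U.card = k) (k := 3 * k)
        (H.card_nbhd_le hdeg) H.self_mem_nbhd H.nbhd_symm fun U hU => by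
          obtain ⟨h1, h2⟩ := Finset.mem_filter.1 hU
          obtain ⟨_, _, W, hW⟩ := hF U h1
          exact ⟨W, by rwa [h2] at hW⟩
      rwa [Fintype.card_fin] at this
    have hw : ∀ U ∈ F.filter (fun U => U.card = k),
        H.subWeight b U ≤ Real.exp (-b * (2 * γ - wbit)) ^ k := by
      intro U hU
      obtain ⟨h1, h2⟩ := Finset.mem_filter.1 hU
      have := H.le_subEnergy hdeg hexp (hF U h1).2.1
      rw [h2] at this
      rw [← Real.exp_nat_mul, subWeight]
      exact Real.exp_le_exp.2 (by nlinarith)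
    calc ∑ U ∈ F.filter (fun U => U.card = k), H.subWeight b U
        ≤ (F.filter fun U => U.card = k).card • Real.exp (-b * (2 * γ - wbit)) ^ k :=
          Finset.sum_le_card_nsmul _ _ _ hw
      _ ≤ (n * (Δ ^ (2 * (3 * k)) * 2 ^ (2 * (3 * k) + 1)) : ℕ) *
            Real.exp (-b * (2 * γ - wbit)) ^ k := by
          rw [nsmul_eq_mul]
          exact mul_le_mul_of_nonneg_right (by exact_mod_cast hcard) (by positivity)
      _ = 2 * n * (64 * (Δ : ℝ) ^ 6 * Real.exp (-b * (2 * γ - wbit))) ^ k := by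
          have e1 : 2 * (3 * k) = 6 * k := by ring
          push_cast
          rw [e1, pow_succ, mul_pow, mul_pow, pow_mul, pow_mul]
          norm_num
          ring
      _ ≤ 2 * n * Real.exp (-2) ^ k := by gcongr
      _ ≤ 2 * n * Real.exp (-s) := by
          rw [← Real.exp_nat_mul]
          have : (s : ℝ) ≤ 2 * k := by exact_mod_cast hsk
          gcongr
          linarith
  refine (Finset.sum_le_card_nsmul _ _ _ key).trans_eq ?_
  rw [Finset.card_range, nsmul_eq_mul]
  push_cast
  ring

/-- The map $y\mapsto(U,y\setminus U)$ is injective and the weight is multiplicative along it, since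
no check joins the two parts. The second part is again sparse, so the sum is bounded by a product of
two sums. -/
lemma sum_outerBoundary_le (H : ParityCheck m n) {wbit wcheck : ℕ} {δ γ b : ℝ}
    (hdeg : H.DegreeBounded wbit wcheck) (hexp : H.IsLeftExpander δ γ) (hb : 0 ≤ b) {s : ℕ}
    (hs : 0 < s) (hsδ : ((1 + (wbit * wcheck + 1 + 2) * s : ℕ) : ℝ) ≤ δ)
    (hcold : 64 * ((wbit * wcheck + 1 : ℕ) : ℝ) ^ 6 * Real.exp (-b * (2 * γ - wbit))
      ≤ Real.exp (-2)) :
    ∑ B ∈ outerBoundary (sparseSets H.nbhd s), H.subWeight b B ≤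
      2 * n * (n + 1) * Real.exp (-s) * ∑ B ∈ sparseSets H.nbhd s, H.subWeight b B := by
  classical
  set Ω := sparseSets H.nbhd s with hΩ
  let P : Finset (Fin n) → Prop := fun U => s ≤ 2 * U.card ∧ (U.card : ℝ) ≤ δ ∧
    ∃ W, IsAnimal H.nbhd W ∧ U ⊆ W ∧ W.card ≤ 3 * U.card
  let F : Finset (Finset (Fin n)) := Finset.univ.filter P
  have hF : ∀ U ∈ F, P U := fun U hU => (Finset.mem_filter.1 hU).2
  have hsplit : ∀ y ∈ outerBoundary Ω, ∃ U, U ⊆ y ∧ U ∈ F ∧ y \ U ∈ Ω ∧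
      H.subWeight b y = H.subWeight b U * H.subWeight b (y \ U) := by
    intro y hy
    obtain ⟨hyΩ, i, hi, hx⟩ := mem_outerBoundary.1 hy
    obtain ⟨U, hUy, hiU, hsep, h1, h2, h3⟩ :=
      exists_separated_part H.self_mem_nbhd (H.card_nbhd_le hdeg) hs hyΩ hi hx
    refine ⟨U, hUy, Finset.mem_filter.2 ⟨Finset.mem_univ _, h1, ?_, h3⟩,
      sparseSets_mono _ _ ?_ hx, ?_⟩
    · exact le_trans (by exact_mod_cast h2) hsδ
    · intro k hk
      obtain ⟨hk1, hk2⟩ := Finset.mem_sdiff.1 hk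
      exact Finset.mem_erase.2 ⟨fun h => hk2 (h ▸ hiU), hk1⟩
    · have := H.subEnergy_union (Finset.disjoint_sdiff (s := U) (t := y))
        (H.disjoint_neighborSet_sdiff hsep)
      rw [Finset.union_sdiff_of_subset hUy] at this
      rw [subWeight, subWeight, subWeight, ← Real.exp_add, this]
      ring_nf
  choose! u hu using hsplit
  have hinj : Set.InjOn (fun y => (u y, y \ u y)) (outerBoundary Ω : Set (Finset (Fin n))) := by
    intro y hy y' hy' h
    simp only [Prod.mk.injEq] at h
    rw [← Finset.union_sdiff_of_subset (hu y hy).1, ← Finset.union_sdiff_of_subset (hu y' hy').1,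
      h.2, h.1]
  calc ∑ B ∈ outerBoundary Ω, H.subWeight b B
      = ∑ p ∈ (outerBoundary Ω).image (fun y => (u y, y \ u y)),
          H.subWeight b p.1 * H.subWeight b p.2 := by
        rw [Finset.sum_image hinj]
        exact Finset.sum_congr rfl fun y hy => (hu y hy).2.2.2
    _ ≤ ∑ p ∈ F ×ˢ Ω, H.subWeight b p.1 * H.subWeight b p.2 := by
        refine Finset.sum_le_sum_of_subset_of_nonneg (fun p hp => ?_) fun p _ _ =>
          mul_nonneg (H.subWeight_pos b _).le (H.subWeight_pos b _).le
        obtain ⟨y, hy, rfl⟩ := Finset.mem_image.1 hp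
        exact Finset.mem_product.2 ⟨(hu y hy).2.1, (hu y hy).2.2.1⟩
    _ = (∑ U ∈ F, H.subWeight b U) * ∑ B ∈ Ω, H.subWeight b B := by
        rw [Finset.sum_product, Finset.sum_mul_sum]
    _ ≤ _ := mul_le_mul_of_nonneg_right (H.sum_subWeight_le hdeg hexp hb hcold hF)
        (Finset.sum_nonneg fun B _ => (H.subWeight_pos b B).le)

/-! ### The decoder -/

/-- A connected component of the difference of two codewords has nonpositive `subEnergy`, as each
check acts on an even number of its bits. -/
lemma subEnergy_nonpos (H : ParityCheck m n) {z z' : Word n} (hz : H.IsCodeword z)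
    (hz' : H.IsCodeword z') {T : Finset (Fin n)} (hT : T ⊆ errorSet z z')
    (h : ∀ u ∈ T, ∀ v ∈ errorSet z z', v ∈ H.nbhd u → v ∈ T) : H.subEnergy T ≤ 0 := by
  classical
  have hcount : ∑ l ∈ T, (H.checks l).card
      = ∑ r ∈ H.neighborSet T, (T.filter fun l => H.TannerAdj l r).card := by
    have := Finset.sum_card_bipartiteAbove_eq_sum_card_bipartiteBelow (s := T)
      (t := H.neighborSet T) H.TannerAdj
    unfold Finset.bipartiteAbove Finset.bipartiteBelow at this
    rw [← this]
    refine Finset.sum_congr rfl fun l hl => congrArg Finset.card ?_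
    ext r
    simp only [mem_checks, Finset.mem_filter, mem_neighborSet]
    exact ⟨fun hr => ⟨⟨l, hl, hr⟩, hr⟩, And.right⟩
  -- If `r` met `T` in the single bit `l`, closedness of `T` would leave `l` as the only nonzero
  -- term of check `r` on `z' - z`, which must vanish.
  have hpar : ∀ r ∈ H.neighborSet T, 2 ≤ (T.filter fun l => H.TannerAdj l r).card := by
    intro r hr
    obtain ⟨l, hl, hlr⟩ := (H.mem_neighborSet _ _).1 hr
    by_contra! hlt
    have huniq : ∀ k, k ≠ l → H r k * (z' k - z k) = 0 := by
      intro k hkl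
      by_contra hne
      have hk1 : H.TannerAdj k r := left_ne_zero_of_mul hne
      have hk2 : k ∈ errorSet z z' :=
        (mem_errorSet z z' k).2 (sub_ne_zero.1 (right_ne_zero_of_mul hne))
      have hk3 : k ∈ T := h l hl k hk2 ((H.mem_nbhd l k).2 (Or.inr ⟨r, hlr, hk1⟩))
      exact hkl (Finset.card_le_one.1 (Nat.le_of_lt_succ hlt) k (Finset.mem_filter.2 ⟨hk3, hk1⟩)
        l (Finset.mem_filter.2 ⟨hl, hlr⟩))
    have hsum : ∑ k, H r k * (z' k - z k) = 0 := by
      have h1 : ∑ k, H r k * z k = 0 := congrFun hz r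
      have h2 : ∑ k, H r k * z' k = 0 := congrFun hz' r
      simp_rw [mul_sub, Finset.sum_sub_distrib, h1, h2, sub_zero]
    rw [Finset.sum_eq_single l (fun k _ hk => huniq k hk) (by simp)] at hsum
    exact mul_ne_zero hlr (sub_ne_zero.2 ((mem_errorSet z z' l).1 (hT hl))) hsum
  have hle := Finset.card_nsmul_le_sum _ _ 2 hpar
  rw [← hcount, smul_eq_mul] at hle
  have hle' : (((H.neighborSet T).card * 2 : ℕ) : ℝ) ≤ (∑ l ∈ T, (H.checks l).card : ℕ) := by
    exact_mod_cast hle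
  push_cast at hle'
  unfold subEnergy
  linarith

/-- A word is within sparse errors of one codeword at most. -/
lemma eq_of_errorSet_mem_sparseSets (H : ParityCheck m n) {wbit wcheck : ℕ} {δ γ : ℝ}
    (hdeg : H.DegreeBounded wbit wcheck) (hexp : H.IsLeftExpander δ γ) (hγ : (wbit : ℝ) / 2 < γ)
    {s : ℕ} (hs : 0 < s) (hsδ : (s : ℝ) ≤ δ) {x z z' : Word n} (hz : H.IsCodeword z)
    (hz' : H.IsCodeword z') (h : errorSet z x ∈ sparseSets H.nbhd s)
    (h' : errorSet z' x ∈ sparseSets H.nbhd s) : z' = z := by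
  by_contra hne
  obtain ⟨j, hj⟩ := Function.ne_iff.1 hne
  -- Growth cannot stop early: a closed `T` with fewer than `s ≤ δ` bits would have `subEnergy`
  -- nonpositive by parity, yet positive by expansion.
  obtain ⟨S, hS, -, hSD, hcard⟩ := (IsAnimal.singleton (nb := H.nbhd) j).exists_superset
    (V₀ := errorSet z z') (k := s) (Finset.singleton_subset_iff.2 ((mem_errorSet z z' j).2 hj))
    (by rwa [Finset.card_singleton]) (by
      intro T hT hjT hTD hTs
      by_contra! hclosed
      have h1 := H.subEnergy_nonpos hz hz' hTD fun u hu v hv hvu => by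
        by_contra hvT
        exact hclosed u hu v (Finset.mem_sdiff.2 ⟨hv, hvT⟩) hvu
      have hTs' : (T.card : ℝ) ≤ s := by exact_mod_cast hTs.le
      have h2 := H.le_subEnergy hdeg hexp (hTs'.trans hsδ)
      have h3 : (0 : ℝ) < T.card := by
        exact_mod_cast Finset.card_pos.2 ⟨j, Finset.singleton_subset_iff.1 hjT⟩
      nlinarith)
  have h1 := mem_sparseSets.1 h S hS hcard
  have h2 := mem_sparseSets.1 h' S hS hcard
  -- Where `z` and `z'` differ, `x` disagrees with one of them, so one of the error sets contains at
  -- least half of `S`.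
  have h3 : S ⊆ (errorSet z x ∩ S) ∪ (errorSet z' x ∩ S) := by
    intro k hk
    have := (mem_errorSet z z' k).1 (hSD hk)
    simp only [Finset.mem_union, Finset.mem_inter, mem_errorSet, hk, and_true]
    by_contra! hc
    exact this (hc.2.symm.trans hc.1)
  have h4 := (Finset.card_le_card h3).trans (Finset.card_union_le _ _)
  omega

open Classical in
/-- The decoder that returns a codeword within sparse errors of the given word, if there is one. -/
noncomputable def sparseDecoder (H : ParityCheck m n) (s : ℕ) : H.Decoder where
  toFun x := if h : ∃ z, H.IsCodeword z ∧ errorSet z x ∈ sparseSets H.nbhd s then h.choose else 0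
  isCodeword x := by
    split_ifs with h
    · exact h.choose_spec.1
    · exact H.mulVec_zero

lemma sparseDecoder_apply (H : ParityCheck m n) {wbit wcheck : ℕ} {δ γ : ℝ}
    (hdeg : H.DegreeBounded wbit wcheck) (hexp : H.IsLeftExpander δ γ) (hγ : (wbit : ℝ) / 2 < γ)
    {s : ℕ} (hs : 0 < s) (hsδ : (s : ℝ) ≤ δ) {x z : Word n} (hz : H.IsCodeword z)
    (h : errorSet z x ∈ sparseSets H.nbhd s) : (H.sparseDecoder s).toFun x = z := by
  have hex : ∃ z, H.IsCodeword z ∧ errorSet z x ∈ sparseSets H.nbhd s := ⟨z, hz, h⟩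
  have e : (H.sparseDecoder s).toFun x = hex.choose := dif_pos hex
  rw [e]
  exact H.eq_of_errorSet_mem_sparseSets hdeg hexp hγ hs hsδ hz hex.choose_spec.1 h
    hex.choose_spec.2

/-- The initial error set is empty and decoding succeeds while the errors stay sparse, so failure is
bounded by `t` times the relative boundary weight. The condition `hsδ` puts the split-off parts
within the range of expansion. -/
lemma memoryFailureProb_sparseDecoder_le (H : ParityCheck m n) (hn : 0 < n) {wbit wcheck : ℕ}
    {δ γ b : ℝ} (hdeg : H.DegreeBounded wbit wcheck) (hexp : H.IsLeftExpander δ γ)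
    (hγ : (wbit : ℝ) / 2 < γ) (hb : 0 ≤ b) {s : ℕ} (hs : 0 < s)
    (hsδ : ((1 + (wbit * wcheck + 1 + 2) * s : ℕ) : ℝ) ≤ δ)
    (hcold : 64 * ((wbit * wcheck + 1 : ℕ) : ℝ) ^ 6 * Real.exp (-b * (2 * γ - wbit))
      ≤ Real.exp (-2)) {z : Word n} (hz : H.IsCodeword z) (t : ℕ) :
    H.memoryFailureProb b (H.sparseDecoder s) z t ≤ t * (2 * n * (n + 1) * Real.exp (-s)) := by
  have hsδ' : (s : ℝ) ≤ δ := by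
    refine le_trans ?_ hsδ
    exact_mod_cast (by nlinarith [Nat.zero_le (wbit * wcheck * s)] :
      s ≤ 1 + (wbit * wcheck + 1 + 2) * s)
  have h1 := H.memoryFailureProb_le hn b (H.sparseDecoder s) z t
    fun x hx => H.sparseDecoder_apply hdeg hexp hγ hs hsδ' hz hx
  have h2 := H.patternSurvival_le_wordSurvival hb (sparseSets_mono (nb := H.nbhd) (s := s)) hz t
    (x := z) (B := ∅) (by intro i; simp [mem_errorSet])
  have h3 := H.le_patternSurvival_empty hn hb (sparseSets_mono (nb := H.nbhd) (s := s)) t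
    (H.sum_outerBoundary_le hdeg hexp hb hs hsδ hcold) (empty_mem_sparseSets hs)
  linarith

end ParityCheck

/-! ### Asymptotics and choice of constants -/

/-- Polynomial factors do not matter against the stretched exponential. -/
lemma tendsto_poly_mul_exp_neg_rpow {β : ℝ} (hβ : 0 < β) {a : ℝ} (ha : 0 < a) :
    Tendsto (fun k : ℕ => ((k : ℝ) * (k : ℝ)) * Real.exp (-a * (k : ℝ) ^ β)) atTop (nhds 0) := by
  have h := (tendsto_rpow_mul_exp_neg_mul_atTop_nhds_zero (2 / β) a ha).comp
    ((tendsto_rpow_atTop hβ).comp tendsto_natCast_atTop_atTop)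
  refine h.congr fun k => ?_
  have hk : (0 : ℝ) ≤ k := Nat.cast_nonneg k
  simp only [Function.comp]
  rw [← Real.rpow_mul hk, mul_div_cancel₀ _ hβ.ne', Real.rpow_two, sq]

/-- At low temperature the Boltzmann factor beats the entropy of connected sets. -/
lemma exists_inverse_temperature (A : ℝ) {κ : ℝ} (hκ : 0 < κ) :
    ∃ b₀ : ℝ, 0 < b₀ ∧ ∀ b, b₀ ≤ b → A * Real.exp (-b * κ) ≤ Real.exp (-2) := by
  have h : Tendsto (fun b : ℝ => A * Real.exp (-(b * κ))) atTop (nhds (A * 0)) :=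
    (Real.tendsto_exp_neg_atTop_nhds_zero.comp (tendsto_id.atTop_mul_const hκ)).const_mul A
  rw [mul_zero] at h
  obtain ⟨B, hB⟩ := eventually_atTop.1 (h.eventually (ge_mem_nhds (Real.exp_pos (-2))))
  refine ⟨max B 1, by positivity, fun b hb => ?_⟩
  rw [neg_mul]
  exact hB b ((le_max_left _ _).trans hb)

theorem mainTheorem8
    (n m : ℕ → ℕ) (hn : Tendsto n atTop atTop)
    (H : ∀ i, ParityCheck (m i) (n i))
    (wbit wcheck : ℕ) (hdeg : ∀ i, (H i).DegreeBounded wbit wcheck)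
    (δ : ℕ → ℝ) (γ : ℝ) (hexp : IsSmallerSetExpanding H δ γ)
    (hγ : (wbit : ℝ) / 2 < γ)
    (β : ℝ) (hβ0 : 0 < β) (hβ1 : β < 1)
    (hδ : ∃ a : ℝ, 0 < a ∧ ∀ᶠ k : ℕ in atTop, a * (k : ℝ) ^ β ≤ δ k) :
    ∃ b₀ : ℝ, 0 < b₀ ∧ ∀ b : ℝ, b₀ ≤ b →
      ∃ c : ℝ, 0 < c ∧ IsSelfCorrecting H b (fun i => Real.exp (c * δ (n i))) := by
  obtain ⟨a, ha, hδ⟩ := hδ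
  obtain ⟨b₀, hb₀, hcold⟩ := exists_inverse_temperature
    (64 * ((wbit * wcheck + 1 : ℕ) : ℝ) ^ 6) (κ := 2 * γ - wbit) (by linarith)
  refine ⟨b₀, hb₀, fun b hb => ?_⟩
  -- One more than the factor of `s` in `hsδ`: the additive 1 there is absorbed because `s ≥ 1`.
  set K : ℝ := ((wbit * wcheck + 4 : ℕ) : ℝ) with hK
  have hK0 : 0 < K := by
    rw [hK]
    positivity
  have hδn : ∀ᶠ i in atTop, a * (n i : ℝ) ^ β ≤ δ (n i) := hn.eventually hδ
  have hδlim : Tendsto (fun i => δ (n i)) atTop atTop :=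
    tendsto_atTop_mono' _ hδn (((tendsto_rpow_atTop hβ0).comp
      (tendsto_natCast_atTop_atTop.comp hn)).const_mul_atTop ha)
  -- Half of the decay rate $1/K$ pays for the number of steps; the other half, with $\delta(n)\ge
  -- an^\beta$, beats the factor $n^2$.
  refine ⟨1 / (2 * K), by positivity, ?_, ?_⟩
  · exact Real.tendsto_exp_atTop.comp (hδlim.const_mul_atTop (by positivity))
  refine ⟨fun i => (H i).sparseDecoder ⌊δ (n i) / K⌋₊, fun η hη => ?_⟩
  have hlim := ((tendsto_poly_mul_exp_neg_rpow hβ0 (a := a / (2 * K)) (by positivity)).comp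
    hn).const_mul (4 * Real.exp 1)
  rw [mul_zero] at hlim
  filter_upwards [hδn, hδlim.eventually_ge_atTop K, hn.eventually_ge_atTop 1,
    hlim.eventually (ge_mem_nhds hη)] with i h1 h2 h3 h4 z hz
  simp only [Function.comp] at h4
  have hq : 1 ≤ δ (n i) / K := by rwa [le_div_iff₀ hK0, one_mul]
  have hs : 0 < ⌊δ (n i) / K⌋₊ := Nat.floor_pos.2 hq
  have hsK : (⌊δ (n i) / K⌋₊ : ℝ) * K ≤ δ (n i) := by
    rw [← le_div_iff₀ hK0]
    exact Nat.floor_le (by linarith)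
  have hs1 : δ (n i) / K - 1 ≤ (⌊δ (n i) / K⌋₊ : ℝ) := (Nat.sub_one_lt_floor _).le
  set s := ⌊δ (n i) / K⌋₊
  have hsδ : ((1 + (wbit * wcheck + 1 + 2) * s : ℕ) : ℝ) ≤ δ (n i) := by
    have : 1 + (wbit * wcheck + 1 + 2) * s ≤ s * (wbit * wcheck + 4) := by nlinarith
    refine le_trans ?_ hsK
    rw [hK]
    exact_mod_cast this
  have hN : (1 : ℝ) ≤ n i := by exact_mod_cast h3
  refine ((H i).memoryFailureProb_sparseDecoder_le h3 (hdeg i) (hexp.2 i) hγ (hb₀.le.trans hb) hs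
    hsδ (hcold b hb) hz _).trans (le_trans ?_ h4)
  -- Rounding in `s` costs a factor $e$, and $n+1\le 2n$.
  calc (⌊Real.exp (1 / (2 * K) * δ (n i))⌋₊ : ℝ) * (2 * n i * (n i + 1) * Real.exp (-s))
      ≤ Real.exp (1 / (2 * K) * δ (n i)) *
          (2 * n i * (n i + n i) * Real.exp (1 - δ (n i) / K)) := by
        gcongr
        · exact Nat.floor_le (Real.exp_pos _).le
        · linarith
    _ = 4 * Real.exp 1 * (n i * n i * Real.exp (-(1 / (2 * K) * δ (n i)))) := by
        have e : 1 - δ (n i) / K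
            = 1 + -(1 / (2 * K) * δ (n i)) + -(1 / (2 * K) * δ (n i)) := by
          field_simp
          ring
        have e' : Real.exp (1 / (2 * K) * δ (n i)) * Real.exp (-(1 / (2 * K) * δ (n i))) = 1 := by
          rw [← Real.exp_add, add_neg_cancel, Real.exp_zero]
        rw [e, Real.exp_add, Real.exp_add]
        linear_combination (4 * Real.exp 1 * (n i * n i *
          Real.exp (-(1 / (2 * K) * δ (n i))))) * e'
    _ ≤ 4 * Real.exp 1 * (n i * n i * Real.exp (-(a / (2 * K)) * (n i : ℝ) ^ β)) := by
        gcongr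
        have : 1 / (2 * K) * (a * (n i : ℝ) ^ β) ≤ 1 / (2 * K) * δ (n i) := by gcongr
        have e : a / (2 * K) * (n i : ℝ) ^ β = 1 / (2 * K) * (a * (n i : ℝ) ^ β) := by ring
        linarith
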